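/- For $1\le p<\infty$ let $X^p(\mathbb{R}_+)$ be the space of functions $f:\mathbb{R}_+\to\mathbb{C}$ such that $x\mapsto f(x)x^{-1/p}$ belongs to $L^p(\mathbb{R}_+)$, with norm $\|f\|_{X^p}=\|f(\cdot)(\cdot)^{-1/p}\|_{L^p(\mathbb{R}_+)}$. Let $\Theta=x\frac{d}{dx}$ be the infinitesimal generator of the group $U(t)f(x)=f(e^tx)$, $t\in\mathbb{R}$, on $X^p(\mathbb{R}_+)$ (derivative of $U(t)f$ at $t=0$ in the norm of $X^p$). Let $\mathbf{B}_\pi^p(\Theta)$ be the set of all $f\in X^p(\mathbb{R}_+)$ that belong to the domains of all powers $\Theta^k$ and satisfy $\|\Theta^kf\|_{X^p}\le\pi^k\|f\|_{X^p}$ for all $k\in\mathbb{N}$. **Theorem.** Let $\{t_k\}_{k\in\mathbb{Z}}$ be a sequence of real numbers with $\sup_{k\in\mathbb{Z}}|t_k-k|<1/4$, and put $$G(z)=(z-t_0)\prod_{k=1}^{\infty}\left(1-\frac{z}{t_k}\right)\left(1-\frac{z}{t_{-k}}\right),\qquad z\in\mathbb{C}.$$ The product (over $k\ge1$, with the factors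 paired as written) converges unconditionally and locally uniformly on $\mathbb{C}$, $G$ is entire, and $G'(t_k)\ne0$ for all $k\in\mathbb{Z}$. Moreover, let $1<p<\infty$, $1/p+1/q=1$, $f\in\mathbf{B}_\pi^p(\Theta)$, $g\in X^q(\mathbb{R}_+)$, and define, for $t\in\mathbb{R}$, $$\Phi(t)=\int_{\mathbb{R}_+}f(e^tx)g(x)\frac{dx}{x},\qquad \Psi(t)=\int_{\mathbb{R}_+}\frac{f(e^tx)-f(x)}{t}\,g(x)\frac{dx}{x}\ \ (t\ne0),\qquad \Psi(0)=\int_{\mathbb{R}_+}\Theta f(x)\,g(x)\frac{dx}{x}.$$ All these integrals converge absolutely, and $$\Psi(t)=\sum_{k\in\mathbb{Z}}\Psi(t_k)\frac{G(t)}{G'(t_k)(t-t_k)},$$ where the series converges unconditionally and uniformly on every compact subset of $\mathbb{R}$ (the quotient $\frac{G(t)}{G'(t_k)(t-t_k)}$ is read as its limit $1$ at $t=t_k$). Consequently, in the same sense, $$\Phi(t)-\Phi(0)=\sum_{k\in\mathbb{Z}}t\,\Psi(t_k)\frac{G(t)}{G'(t_k)(t-t_k)}.$$ -/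

import Mathlib

open MeasureTheory Filter Topology Set

noncomputable section

/-- The norm of the Mellin-Lebesgue space `X^p(ℝ₊)`, `1 ≤ p < ∞`: the `L^p(0,∞)` norm of
`x ↦ f(x) x^{-1/p}`. Functions on `ℝ₊` are represented by functions on `ℝ`, of which only the values
on `(0,∞)` matter. -/
def mellinXNorm (p : ℝ) (f : ℝ → ℂ) : ENNReal :=
  eLpNorm (fun x : ℝ => f x * ((x ^ (-1 / p) : ℝ) : ℂ)) (ENNReal.ofReal p)
    (volume.restrict (Ioi (0 : ℝ)))

/-- Membership in `X^p(ℝ₊)`: `f(x) x^{-1/p}` is in `L^p(0,∞)`. -/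
def MemMellinX (p : ℝ) (f : ℝ → ℂ) : Prop :=
  MemLp (fun x : ℝ => f x * ((x ^ (-1 / p) : ℝ) : ℂ)) (ENNReal.ofReal p)
    (volume.restrict (Ioi (0 : ℝ)))

/-- The Mellin translations `(U(s) f)(x) = f(e^s x)`. -/
def mellinTranslate (s : ℝ) (f : ℝ → ℂ) : ℝ → ℂ := fun x => f (Real.exp s * x)

/-- `f` is in the domain of the infinitesimal generator `Θ = x d/dx` of the group `U` on `X^p(ℝ₊)`
and `Θ f = h` (almost everywhere): the quotients `(U(s) f - f) / s` converge to `h` in `X^p(ℝ₊)`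
as `s → 0`. -/
def IsMellinTheta (p : ℝ) (f h : ℝ → ℂ) : Prop :=
  MemMellinX p f ∧ MemMellinX p h ∧
    Tendsto (fun s : ℝ => mellinXNorm p (fun x => (mellinTranslate s f x - f x) / (s : ℂ) - h x))
      (𝓝[≠] 0) (𝓝 0)

open Classical in
/-- The generator `Θ` on `X^p(ℝ₊)`: a representative of `Θ f` (unique up to null sets) if `f` is in
the domain, and zero otherwise. -/
def mellinTheta (p : ℝ) (f : ℝ → ℂ) : ℝ → ℂ :=
  if hf : ∃ h, IsMellinTheta p f h then hf.choose else 0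

/-- The domain `D^k(Θ)` of the power `Θ^k` in `X^p(ℝ₊)`. -/
def MemMellinDomain (p : ℝ) (k : ℕ) (f : ℝ → ℂ) : Prop :=
  MemMellinX p f ∧ ∀ j < k, ∃ h, IsMellinTheta p ((mellinTheta p)^[j] f) h

/-- The Bernstein space `B_σ^p(Θ)`: all `f ∈ D^∞(Θ)` with `‖Θ^k f‖ ≤ σ^k ‖f‖` in `X^p(ℝ₊)` for
all `k`. -/
def MemMellinBernstein (p σ : ℝ) (f : ℝ → ℂ) : Prop :=
  (∀ k : ℕ, MemMellinDomain p k f) ∧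
    ∀ k : ℕ, mellinXNorm p ((mellinTheta p)^[k] f) ≤ ENNReal.ofReal (σ ^ k) * mellinXNorm p f

/-- The pairing `Φ(s) = ∫_{ℝ₊} f(e^s x) g(x) dx/x`. -/
def mellinPhi (f g : ℝ → ℂ) (s : ℝ) : ℂ :=
  ∫ x in Ioi (0 : ℝ), mellinTranslate s f x * g x / (x : ℂ)

/-- The function `Ψ(s) = ∫_{ℝ₊} ((f(e^s x) - f(x)) / s) g(x) dx/x` for `s ≠ 0`, and
`Ψ(0) = ∫_{ℝ₊} (Θ f)(x) g(x) dx/x`. -/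
def mellinPsi (p : ℝ) (f g : ℝ → ℂ) (s : ℝ) : ℂ :=
  if s = 0 then ∫ x in Ioi (0 : ℝ), mellinTheta p f x * g x / (x : ℂ)
  else ∫ x in Ioi (0 : ℝ), (mellinTranslate s f x - f x) / (s : ℂ) * g x / (x : ℂ)

/-- The factor `(1 - z / t_k) (1 - z / t_{-k})`, with `k = n + 1 ≥ 1`, of the canonical product. -/
def samplingFactor (t : ℤ → ℝ) (n : ℕ) (z : ℂ) : ℂ :=
  (1 - z / (t ((n : ℤ) + 1) : ℂ)) * (1 - z / (t (-((n : ℤ) + 1)) : ℂ))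

/-- The canonical product `G(z) = (z - t_0) ∏_{k ≥ 1} (1 - z / t_k) (1 - z / t_{-k})`. -/
def samplingG (t : ℤ → ℝ) (z : ℂ) : ℂ :=
  (z - (t 0 : ℂ)) * ∏' n : ℕ, samplingFactor t n z

/-- The function `s ↦ G(s) / (G'(t_k) (s - t_k))` on `ℝ`, with the value `1` at the removable
singularity `s = t_k`. -/
def samplingKernel (t : ℤ → ℝ) (k : ℤ) (s : ℝ) : ℂ :=
  if s = t k then 1
  else samplingG t (s : ℂ) / (deriv (samplingG t) (t k : ℂ) * ((s : ℂ) - (t k : ℂ)))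

end

/-! Pairing `f` with `g` turns the Mellin translation group into the function `Φ` on `ℝ`, whose
`k`-th derivative at `s` is the pairing of `U(s) Θ^k f` with `g`. By Hölder's inequality it is
bounded by `π^k M`, so `Φ` extends to an entire function bounded by `M exp (π |Im z|)`, and its
difference quotient `Ψ` extends to an entire function `P` with `(1 + |z|) |P z| ≤ C exp (π |Im z|)`.

Let `|t_k - k| ≤ L < 1/2`. Comparing `G` factor by factor with products of linear factors, which are
quotients of Gamma values, and with the product of `sinh` shows that `|G z|` is at least a constant
times `|z - t_m| (1 + |Re z|)^(-2L) (1 + |m|)^(-2L) (1 + |Im z|)⁻³ exp (π |Im z|)`, where `m` is the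
integer nearest to `Re z`. If `(1 + |z|)⁶ |P z| ≤ C exp (π |Im z|)`, the maximum principle for the
quotient of the interpolation error by `G` on the discs `|z| ≤ N + 1/2` gives the sampling series.
A general `P` is dilated and multiplied by five `sinc` factors, which produces this decay without
increasing the type; the regularization is removed by dominated convergence, the majorant being
`(1 + |t_k|)^(-(2 - 4L))`. Its summability is what requires `L < 1/4`. -/

lemma map_sub_add_map_add_le_of_convexOn {s : Set ℝ} {f : ℝ → ℝ} (hf : ConvexOn ℝ s f) {a h h' : ℝ}
    (hh : |h| ≤ h') (hl : a - h' ∈ s) (hr : a + h' ∈ s) :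
    f (a - h) + f (a + h) ≤ f (a - h') + f (a + h') := by
  obtain ⟨hneg, hpos⟩ := abs_le.1 hh
  rcases ((abs_nonneg h).trans hh).eq_or_lt with rfl | hh'
  · obtain rfl : h = 0 := by linarith
    rfl
  set α := (h' + h) / (2 * h') with hα
  set β := (h' - h) / (2 * h') with hβ
  have hα0 : 0 ≤ α := div_nonneg (by linarith) (by linarith)
  have hβ0 : 0 ≤ β := div_nonneg (by linarith) (by linarith)
  have hsum : α + β = 1 := by
    rw [hα, hβ]
    field_simp
    ring
  have hdiff : (α - β) * h' = h := by
    rw [hα, hβ]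
    field_simp
    ring
  have hleft : α • (a - h') + β • (a + h') = a - h := by
    simp only [smul_eq_mul]
    linear_combination a * hsum - hdiff
  have hright : β • (a - h') + α • (a + h') = a + h := by
    simp only [smul_eq_mul]
    linear_combination a * hsum + hdiff
  have hfl := hf.2 hl hr hα0 hβ0 hsum
  have hfr := hf.2 hl hr hβ0 hα0 (by rw [add_comm, hsum])
  rw [hleft, smul_eq_mul, smul_eq_mul] at hfl
  rw [hright, smul_eq_mul, smul_eq_mul] at hfr
  linear_combination hfl + hfr + hsum * (f (a - h') + f (a + h'))

lemma Gamma_sub_mul_Gamma_add_le {a h h' : ℝ} (hh : |h| ≤ h') (ha : h' < a) :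
    Real.Gamma (a - h) * Real.Gamma (a + h) ≤ Real.Gamma (a - h') * Real.Gamma (a + h') := by
  have hΓ {b : ℝ} (hb : |b| ≤ h') : 0 < Real.Gamma (a - b) ∧ 0 < Real.Gamma (a + b) := by
    have hb' := abs_le.1 hb
    exact ⟨Real.Gamma_pos_of_pos (by linarith), Real.Gamma_pos_of_pos (by linarith)⟩
  have hh' : 0 ≤ h' := (abs_nonneg h).trans hh
  obtain ⟨hl, hr⟩ := hΓ hh
  obtain ⟨hl', hr'⟩ := hΓ (abs_of_nonneg hh').le
  rw [← Real.log_le_log_iff (mul_pos hl hr) (mul_pos hl' hr'), Real.log_mul hl.ne' hr.ne',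
    Real.log_mul hl'.ne' hr'.ne']
  exact map_sub_add_map_add_le_of_convexOn Real.convexOn_log_Gamma hh
    (mem_Ioi.2 (by linarith)) (mem_Ioi.2 (by linarith))

lemma Gamma_add_le_rpow_mul_Gamma {u s : ℝ} (hu : 0 < u) (hs0 : 0 ≤ s) (hs1 : s ≤ 1) :
    Real.Gamma (u + s) ≤ u ^ s * Real.Gamma u := by
  rcases hs0.eq_or_lt with rfl | hs0
  · simp
  rcases hs1.eq_or_lt with rfl | hs1
  · rw [Real.Gamma_add_one hu.ne', Real.rpow_one]
  have hG := Real.Gamma_pos_of_pos hu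
  calc Real.Gamma (u + s) = Real.Gamma ((1 - s) * u + s * (u + 1)) := by ring_nf
    _ ≤ Real.Gamma u ^ (1 - s) * Real.Gamma (u + 1) ^ s :=
      Real.Gamma_mul_add_mul_le_rpow_Gamma_mul_rpow_Gamma hu (by linarith) (by linarith) hs0
        (by ring)
    _ = u ^ s * Real.Gamma u := by
      rw [Real.Gamma_add_one hu.ne', Real.mul_rpow hu.le hG.le, mul_left_comm,
        ← Real.rpow_add hG, sub_add_cancel, Real.rpow_one]

lemma prod_range_add_eq_Gamma_div {s : ℝ} (hs : 0 < s) (n : ℕ) :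
    ∏ i ∈ Finset.range n, (s + i) = Real.Gamma (s + n) / Real.Gamma s := by
  induction n with
  | zero => simp [(Real.Gamma_pos_of_pos hs).ne']
  | succ n ih =>
    rw [Finset.prod_range_succ, ih, Nat.cast_succ, ← add_assoc, Real.Gamma_add_one (by positivity)]
    ring

lemma multipliable_one_add_sq_div (y : ℝ) :
    Multipliable fun j : ℕ => 1 + y ^ 2 / ((j : ℝ) + 1) ^ 2 := by
  refine Real.multipliable_one_add_of_summable ?_
  have hsum := (summable_nat_add_iff 1).2 (Real.summable_one_div_nat_pow.2 one_lt_two)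
  refine (hsum.mul_left (y ^ 2)).congr fun j => ?_
  push_cast
  ring

lemma pi_mul_mul_tprod_eq_sinh (y : ℝ) :
    Real.pi * y * ∏' j : ℕ, (1 + y ^ 2 / ((j : ℝ) + 1) ^ 2) = Real.sinh (Real.pi * y) := by
  have hreal := ((multipliable_one_add_sq_div y).hasProd.tendsto_prod_nat).const_mul (Real.pi * y)
  have hcomplex := (Complex.tendsto_euler_sin_prod (y * Complex.I)).div_const Complex.I
  have hlim : Complex.sin (Real.pi * (y * Complex.I)) / Complex.I =
      (Real.sinh (Real.pi * y) : ℂ) := by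
    rw [← mul_assoc, Complex.sin_mul_I, mul_div_cancel_right₀ _ Complex.I_ne_zero]
    push_cast; rfl
  rw [hlim] at hcomplex
  refine tendsto_nhds_unique hreal ?_
  refine ((Complex.continuous_re.tendsto _).comp hcomplex).congr fun n => ?_
  have hterm (j : ℕ) : (1 : ℂ) - (y * Complex.I) ^ 2 / (j + 1) ^ 2 =
      ((1 + y ^ 2 / ((j : ℝ) + 1) ^ 2 : ℝ) : ℂ) := by
    push_cast; rw [mul_pow, Complex.I_sq]; ring
  simp only [Function.comp_apply, hterm]
  rw [← Complex.ofReal_prod, ← mul_assoc, mul_right_comm, mul_div_cancel_right₀ _ Complex.I_ne_zero,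
    ← Complex.ofReal_mul, ← Complex.ofReal_mul, Complex.ofReal_re]

lemma mul_exp_le_one_add_mul_sinh (u : ℝ) :
    u * Real.exp u ≤ (1 + 2 * u) * Real.sinh u := by
  have h : Real.exp (-u) * (1 + 2 * u) ≤ Real.exp u := by
    calc Real.exp (-u) * (1 + 2 * u) ≤ Real.exp (-u) * Real.exp (2 * u) := by
          gcongr; linarith [Real.add_one_le_exp (2 * u)]
      _ = Real.exp u := by rw [← Real.exp_add]; ring_nf
  rw [Real.sinh_eq]
  linarith

lemma exp_pi_mul_abs_le_tprod (y : ℝ) :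
    Real.exp (Real.pi * |y|) ≤
      (1 + 2 * (Real.pi * |y|)) * ∏' j : ℕ, (1 + y ^ 2 / ((j : ℝ) + 1) ^ 2) := by
  rcases eq_or_ne y 0 with rfl | hy
  · simp
  have hpos : 0 < Real.pi * |y| := mul_pos Real.pi_pos (abs_pos.2 hy)
  have hsinh := pi_mul_mul_tprod_eq_sinh |y|
  simp only [sq_abs] at hsinh
  refine le_of_mul_le_mul_left ?_ hpos
  calc Real.pi * |y| * Real.exp (Real.pi * |y|)
      ≤ (1 + 2 * (Real.pi * |y|)) * Real.sinh (Real.pi * |y|) :=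
        mul_exp_le_one_add_mul_sinh _
    _ = _ := by rw [← hsinh]; ring

section CanonicalProduct

variable {t : ℤ → ℝ} {L : ℝ}

lemma abs_intCast_le_two_mul_abs_node (hL : L < 1 / 2) (ht : ∀ k, |t k - k| ≤ L) (k : ℤ) :
    |(k : ℝ)| ≤ 2 * |t k| := by
  rcases eq_or_ne k 0 with rfl | hk
  · simp
  have hone : (1 : ℝ) ≤ |(k : ℝ)| := mod_cast Int.one_le_abs hk
  have hdist := abs_sub_abs_le_abs_sub (k : ℝ) (t k)
  rw [abs_sub_comm] at hdist
  linarith [ht k]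

lemma node_ne_zero (hL : L < 1 / 2) (ht : ∀ k, |t k - k| ≤ L) {k : ℤ} (hk : k ≠ 0) : t k ≠ 0 := by
  intro h0
  have h := abs_intCast_le_two_mul_abs_node hL ht k
  rw [h0, abs_zero, mul_zero, abs_nonpos_iff, Int.cast_eq_zero] at h
  exact hk h

lemma one_sub_div_mul_one_sub_div_sub_one {z a b : ℂ} (ha : a ≠ 0) (hb : b ≠ 0) :
    (1 - z / a) * (1 - z / b) - 1 = (z ^ 2 - z * (a + b)) / (a * b) := by
  field_simp
  ring

/-- The linear terms of paired factors almost cancel, as `t_k + t_{-k}` stays bounded. -/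
lemma norm_samplingFactor_sub_one_le (hL : L < 1 / 2) (ht : ∀ k, |t k - k| ≤ L) (n : ℕ) {z : ℂ}
    {B : ℝ} (hz : ‖z‖ ≤ B) :
    ‖samplingFactor t n z - 1‖ ≤ 4 * (B ^ 2 + B) * (1 / ((n : ℝ) + 1) ^ 2) := by
  have hB : 0 ≤ B := (norm_nonneg z).trans hz
  have hpos : ((n : ℤ) + 1) ≠ 0 := by lia
  have hne {k : ℤ} (hk : k ≠ 0) : (t k : ℂ) ≠ 0 := mod_cast node_ne_zero hL ht hk
  have hright := ht (n + 1)
  have hleft := ht (-(n + 1))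
  have hright' := abs_intCast_le_two_mul_abs_node hL ht (n + 1)
  have hleft' := abs_intCast_le_two_mul_abs_node hL ht (-(n + 1))
  push_cast [abs_neg] at hright hleft hright' hleft'
  rw [abs_of_pos (by positivity : (0 : ℝ) < n + 1)] at hright' hleft'
  have hnum : ‖z ^ 2 - z * (t (n + 1) + t (-(n + 1)))‖ ≤ B ^ 2 + B := by
    have hsum : ‖(t (n + 1) + t (-(n + 1)) : ℂ)‖ ≤ 1 := by
      rw [← Complex.ofReal_add, Complex.norm_real, Real.norm_eq_abs, abs_le]
      rw [abs_le] at hright hleft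
      constructor <;> linarith
    calc _ ≤ ‖z‖ ^ 2 + ‖z‖ * ‖(t (n + 1) + t (-(n + 1)) : ℂ)‖ :=
          (norm_sub_le _ _).trans_eq (by rw [norm_pow, norm_mul])
      _ ≤ B ^ 2 + B * 1 := by gcongr
      _ = B ^ 2 + B := by ring
  rw [samplingFactor, one_sub_div_mul_one_sub_div_sub_one (hne hpos) (hne (neg_ne_zero.2 hpos)),
    norm_div, norm_mul, Complex.norm_real, Complex.norm_real, Real.norm_eq_abs, Real.norm_eq_abs]
  calc _ ≤ (B ^ 2 + B) / (((n : ℝ) + 1) / 2 * (((n : ℝ) + 1) / 2)) := by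
        gcongr <;> linarith
    _ = 4 * (B ^ 2 + B) * (1 / ((n : ℝ) + 1) ^ 2) := by field_simp; norm_num

lemma differentiable_samplingFactor (t : ℤ → ℝ) (n : ℕ) :
    Differentiable ℂ (samplingFactor t n) := by
  unfold samplingFactor
  fun_prop

lemma hasProdLocallyUniformlyOn_samplingFactor (hL : L < 1 / 2) (ht : ∀ k, |t k - k| ≤ L) :
    HasProdLocallyUniformlyOn (samplingFactor t) (fun z => ∏' n : ℕ, samplingFactor t n z)
      univ := by
  refine hasProdLocallyUniformlyOn_of_forall_compact isOpen_univ fun K _ hK => ?_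
  obtain ⟨B, hB⟩ := hK.isBounded.exists_norm_le
  have hsum : Summable fun n : ℕ => 4 * (B ^ 2 + B) * (1 / ((n : ℝ) + 1) ^ 2) :=
    .mul_left _ (mod_cast (summable_nat_add_iff 1).2 (Real.summable_one_div_nat_pow.2 one_lt_two))
  have h := hsum.hasProdUniformlyOn_nat_one_add (f := fun n z => samplingFactor t n z - 1) hK
    (.of_forall fun n z hz => norm_samplingFactor_sub_one_le hL ht n (hB z hz))
    fun n => ((differentiable_samplingFactor t n).continuous.sub continuous_const).continuousOn
  simpa only [add_sub_cancel] using h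

lemma tendsto_mul_prod_samplingFactor (hL : L < 1 / 2) (ht : ∀ k, |t k - k| ≤ L) (z : ℂ) :
    Tendsto (fun n => (z - t 0) * ∏ j ∈ Finset.range n, samplingFactor t j z) atTop
      (𝓝 (samplingG t z)) :=
  ((hasProdLocallyUniformlyOn_samplingFactor hL ht).hasProd
    (mem_univ z)).tendsto_prod_nat.const_mul _

lemma differentiable_samplingG (hL : L < 1 / 2) (ht : ∀ k, |t k - k| ≤ L) :
    Differentiable ℂ (samplingG t) := by
  have h := (hasProdLocallyUniformlyOn_samplingFactor hL ht).differentiableOn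
    (.of_forall fun s => (Differentiable.fun_finsetProd fun n _ =>
      differentiable_samplingFactor t n).differentiableOn) isOpen_univ
  exact (differentiable_id.sub_const _).mul (differentiableOn_univ.1 h)

lemma samplingG_apply_node (hL : L < 1 / 2) (ht : ∀ k, |t k - k| ≤ L) (m : ℤ) :
    samplingG t (t m) = 0 := by
  have hdiv {k : ℤ} (hk : k ≠ 0) : (1 : ℂ) - t k / t k = 0 := by
    rw [div_self (mod_cast node_ne_zero hL ht hk), sub_self]
  obtain ⟨_ | n, rfl | rfl⟩ := m.eq_nat_or_neg
  · simp [samplingG]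
  · simp [samplingG]
  · refine mul_eq_zero_of_right _ (tprod_of_exists_eq_zero ⟨n, mul_eq_zero_of_left ?_ _⟩)
    exact hdiv (k := (n : ℤ) + 1) (by lia)
  · refine mul_eq_zero_of_right _ (tprod_of_exists_eq_zero ⟨n, mul_eq_zero_of_right _ ?_⟩)
    exact hdiv (k := -((n : ℤ) + 1)) (by lia)

lemma samplingG_reflect (t : ℤ → ℝ) (z : ℂ) :
    samplingG (fun k => -t (-k)) (-z) = -samplingG t z := by
  have hfactor (n : ℕ) : samplingFactor (fun k => -t (-k)) n (-z) = samplingFactor t n z := by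
    simp only [samplingFactor, neg_neg, Complex.ofReal_neg, neg_div_neg_eq]
    exact mul_comm _ _
  simp only [samplingG, hfactor, neg_zero, Complex.ofReal_neg]
  ring

end CanonicalProduct

/-- A lower bound for `|z - τ| / |Re z - τ|` when `Im z = y` and `|Re z - τ| ≤ i + 2`. It is applied
to the nodes `τ` whose index differs by `i + 1` from the integer nearest to `Re z`. -/
noncomputable def verticalGain (y : ℝ) (i : ℕ) : ℝ := √(1 + (y / (i + 2)) ^ 2)

lemma one_le_verticalGain (y : ℝ) (i : ℕ) : 1 ≤ verticalGain y i :=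
  Real.one_le_sqrt.2 (le_add_of_nonneg_right (sq_nonneg _))

lemma mul_verticalGain_le_norm_sub {z : ℂ} {τ b : ℝ} {i : ℕ} (hb0 : 0 ≤ b) (hb : b ≤ |z.re - τ|)
    (hbi : b ≤ i + 2) : b * verticalGain z.im i ≤ ‖z - τ‖ := by
  have hratio : (b / (i + 2)) ^ 2 ≤ 1 :=
    pow_le_one₀ (by positivity) ((div_le_one (by positivity)).2 hbi)
  refine abs_le_of_sq_le_sq' ?_ (norm_nonneg _) |>.2
  calc (b * verticalGain z.im i) ^ 2 = b ^ 2 + (b / (i + 2)) ^ 2 * z.im ^ 2 := by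
        rw [verticalGain, mul_pow, Real.sq_sqrt (by positivity)]
        ring
    _ ≤ |z.re - τ| ^ 2 + 1 * z.im ^ 2 := by gcongr
    _ = ‖z - τ‖ ^ 2 := by
        rw [Complex.sq_norm, Complex.normSq_apply, sq_abs]
        simp only [Complex.sub_re, Complex.sub_im, Complex.ofReal_re, Complex.ofReal_im]
        ring

lemma norm_one_sub_div_ofReal {τ : ℝ} (hτ : τ ≠ 0) (z : ℂ) : ‖1 - z / τ‖ = ‖z - τ‖ / |τ| := by
  have hτ' : (τ : ℂ) ≠ 0 := mod_cast hτ
  rw [one_sub_div hτ', norm_div, norm_sub_rev, Complex.norm_real, Real.norm_eq_abs]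

lemma mul_verticalGain_le_norm_one_sub_div {z : ℂ} {τ r : ℝ} {i : ℕ} (hτ : τ ≠ 0) (hr0 : 0 ≤ r)
    (hr : r ≤ |1 - z.re / τ|) (hi : |z.re - τ| ≤ i + 2) :
    r * verticalGain z.im i ≤ ‖1 - z / τ‖ := by
  rw [norm_one_sub_div_ofReal hτ, le_div_iff₀ (abs_pos.2 hτ), mul_right_comm]
  have hrτ : r * |τ| ≤ |z.re - τ| := by
    rwa [one_sub_div hτ, abs_div, abs_sub_comm, le_div_iff₀ (abs_pos.2 hτ)] at hr
  exact mul_verticalGain_le_norm_sub (by positivity) hrτ (hrτ.trans hi)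

lemma tendsto_prod_verticalGain_sq (y : ℝ) :
    Tendsto (fun d => (∏ i ∈ Finset.range d, verticalGain y i) ^ 2) atTop
      (𝓝 ((∏' j : ℕ, (1 + y ^ 2 / ((j : ℝ) + 1) ^ 2)) / (1 + y ^ 2))) := by
  have hlim := (tendsto_add_atTop_iff_nat 1).2
    (multipliable_one_add_sq_div y).hasProd.tendsto_prod_nat
  refine (hlim.div_const (1 + y ^ 2)).congr fun d => ?_
  have hy : 1 + y ^ 2 ≠ 0 := by positivity
  rw [Finset.prod_range_succ', ← Finset.prod_pow]
  simp only [Nat.cast_zero, zero_add, one_pow, div_one, mul_div_cancel_right₀ _ hy]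
  refine Finset.prod_congr rfl fun i _ => ?_
  rw [verticalGain, Real.sq_sqrt (by positivity), div_pow]
  push_cast
  ring

section FactorBounds

variable {t : ℤ → ℝ} {L : ℝ} {z : ℂ} {m : ℕ}

lemma le_norm_one_sub_div_node_neg (hL : L < 1 / 2) (ht : ∀ k, |t k - k| ≤ L) (hz : 0 ≤ z.re)
    (hm : |z.re - m| ≤ 1 / 2) (j : ℕ) :
    (1 + L + z.re + j) / (1 + L + j) * verticalGain z.im (m + j) ≤
      ‖1 - z / t (-(j + 1))‖ := by
  have hτ := abs_le.1 (ht (-(j + 1)))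
  have hm' := abs_le.1 hm
  push_cast at hτ
  have hL0 : 0 ≤ L := (abs_nonneg _).trans (ht 0)
  have hneg : t (-(j + 1)) < 0 := by linarith
  have hpos : 0 < 1 + L + j := by linarith
  refine mul_verticalGain_le_norm_one_sub_div hneg.ne (by positivity) ?_ ?_
  · refine le_abs.2 (.inl ?_)
    rw [add_right_comm, add_div, div_self hpos.ne', sub_eq_add_neg, ← div_neg]
    gcongr <;> linarith
  · push_cast
    rw [abs_le]
    constructor <;> linarith

lemma le_norm_one_sub_div_node (hL : L < 1 / 2) (ht : ∀ k, |t k - k| ≤ L) (hz : 0 ≤ z.re)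
    (hm : |z.re - m| ≤ 1 / 2) (i : ℕ) :
    (m + 1 - L - z.re + i) / (m + 1 - L + i) * verticalGain z.im i ≤
      ‖1 - z / t ((m + i : ℕ) + 1)‖ := by
  have hτ := abs_le.1 (ht ((m + i : ℕ) + 1))
  have hm' := abs_le.1 hm
  push_cast at hτ ⊢
  have hpos : 0 < m + 1 - L + i := by linarith
  have htpos : 0 < t (m + i + 1) := by linarith
  refine mul_verticalGain_le_norm_one_sub_div htpos.ne' ?_ ?_ ?_
  · exact div_nonneg (by linarith) hpos.le
  · refine le_abs.2 (.inl ?_)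
    rw [sub_add_eq_add_sub, sub_div, div_self hpos.ne']
    gcongr
    linarith
  · rw [abs_le]
    constructor <;> linarith

lemma le_norm_sub_node (hL : L < 1 / 2) (ht : ∀ k, |t k - k| ≤ L) (hm : |z.re - m| ≤ 1 / 2) {i : ℕ}
    (hi : i < m) :
    (z.re - m + 1 - L + i) * verticalGain z.im i ≤ ‖z - t (m - 1 - i : ℕ)‖ := by
  have hτ := abs_le.1 (ht (m - 1 - i : ℕ))
  have hm' := abs_le.1 hm
  have hL0 : 0 ≤ L := (abs_nonneg _).trans (ht 0)
  have hcast : ((m - 1 - i : ℕ) : ℝ) = m - 1 - i := by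
    rw [Nat.cast_sub (by lia), Nat.cast_sub (by lia), Nat.cast_one]
  rw [Int.cast_natCast, hcast] at hτ
  refine mul_verticalGain_le_norm_sub (by linarith) (le_abs.2 (.inl ?_)) ?_ <;> linarith

end FactorBounds

section PartialProducts

variable {t : ℤ → ℝ} {L : ℝ} {z : ℂ} {m : ℕ}

lemma norm_sub_node_mul_le_mul_prod (hL : L < 1 / 2) (ht : ∀ k, |t k - k| ≤ L)
    (hm : |z.re - m| ≤ 1 / 2) :
    ‖z - t m‖ * ∏ i ∈ Finset.range m,
        ((z.re - m + 1 - L + i) / (1 + L + i) * verticalGain z.im i) ≤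
      ‖z - t 0‖ * ∏ j ∈ Finset.range m, ‖1 - z / t (j + 1)‖ := by
  have hL0 : 0 ≤ L := (abs_nonneg _).trans (ht 0)
  have hdiv (j : ℕ) : ‖z - t (j + 1 : ℕ)‖ / (1 + L + j) ≤ ‖1 - z / t (j + 1)‖ := by
    have hτ := abs_le.1 (ht (j + 1))
    push_cast at hτ ⊢
    have hτ0 : 0 < t (j + 1) := by linarith [j.cast_nonneg (α := ℝ)]
    rw [norm_one_sub_div_ofReal hτ0.ne', abs_of_pos hτ0]
    gcongr
    linarith
  have hnodes : ∏ i ∈ Finset.range m, ((z.re - m + 1 - L + i) * verticalGain z.im i) ≤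
      ∏ k ∈ Finset.range m, ‖z - t k‖ := by
    rw [← Finset.prod_range_reflect fun k => ‖z - t (k : ℕ)‖]
    refine Finset.prod_le_prod (fun i _ => ?_) fun i hi =>
      le_norm_sub_node hL ht hm (Finset.mem_range.1 hi)
    have := (abs_le.1 hm).1
    exact mul_nonneg (by linarith [i.cast_nonneg (α := ℝ)]) (Real.sqrt_nonneg _)
  calc _ = ‖z - t m‖ * (∏ i ∈ Finset.range m, ((z.re - m + 1 - L + i) * verticalGain z.im i)) /
        ∏ i ∈ Finset.range m, (1 + L + i) := by
        rw [mul_div_assoc, ← Finset.prod_div_distrib]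
        simp only [div_mul_eq_mul_div]
    _ ≤ ‖z - t m‖ * (∏ k ∈ Finset.range m, ‖z - t k‖) / ∏ i ∈ Finset.range m, (1 + L + i) := by
        gcongr
    _ = ‖z - t 0‖ * ∏ j ∈ Finset.range m, (‖z - t (j + 1 : ℕ)‖ / (1 + L + j)) := by
        rw [mul_comm, ← Finset.prod_range_succ (fun k : ℕ => ‖z - t k‖), Finset.prod_range_succ',
          Finset.prod_div_distrib, Nat.cast_zero, mul_comm, mul_div_assoc]
    _ ≤ _ := by gcongr with j; exact hdiv j

/-- The nodes on the left half-line only contribute gains of index at least `m`; the missing ones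
come from the `m` nodes between `0` and the integer nearest to `Re z`. -/
lemma prod_verticalGain_sq_le (y : ℝ) (m d : ℕ) :
    (∏ i ∈ Finset.range d, verticalGain y i) ^ 2 ≤
      (∏ i ∈ Finset.range m, verticalGain y i) * (∏ i ∈ Finset.range d, verticalGain y i) *
        ∏ j ∈ Finset.range (m + d), verticalGain y (m + j) := by
  have hpos (s : Finset ℕ) : 0 ≤ ∏ i ∈ s, verticalGain y i :=
    Finset.prod_nonneg fun i _ => zero_le_one.trans (one_le_verticalGain y i)
  have hmono : ∏ i ∈ Finset.range d, verticalGain y i ≤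
      ∏ i ∈ Finset.range (m + (m + d)), verticalGain y i :=
    Finset.prod_le_prod_of_subset_of_one_le (Finset.range_mono (by lia))
      (fun i _ => zero_le_one.trans (one_le_verticalGain y i)) fun i _ _ => one_le_verticalGain y i
  rw [mul_right_comm, ← Finset.prod_range_add, sq]
  gcongr
  exact hpos _

lemma norm_mul_prod_samplingFactor (t : ℤ → ℝ) (z : ℂ) (m d : ℕ) :
    ‖(z - t 0) * ∏ j ∈ Finset.range (m + d), samplingFactor t j z‖ =
      ‖z - t 0‖ * (∏ j ∈ Finset.range m, ‖1 - z / t (j + 1)‖) *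
        (∏ i ∈ Finset.range d, ‖1 - z / t ((m + i : ℕ) + 1)‖) *
        ∏ j ∈ Finset.range (m + d), ‖1 - z / t (-(j + 1))‖ := by
  simp only [samplingFactor, norm_mul, norm_prod, Finset.prod_mul_distrib,
    Finset.prod_range_add (fun j : ℕ => ‖1 - z / t (j + 1)‖), mul_assoc]

lemma norm_sub_node_mul_prod_le_norm_partialProduct (hL : L < 1 / 2) (ht : ∀ k, |t k - k| ≤ L)
    (hz : 0 ≤ z.re) (hm : |z.re - m| ≤ 1 / 2) (d : ℕ) :
    ‖z - t m‖ * ((∏ i ∈ Finset.range m, (z.re - m + 1 - L + i) / (1 + L + i)) *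
        (∏ i ∈ Finset.range d, (m + 1 - L - z.re + i) / (m + 1 - L + i)) *
        ∏ j ∈ Finset.range (m + d), (1 + L + z.re + j) / (1 + L + j)) *
        (∏ i ∈ Finset.range d, verticalGain z.im i) ^ 2 ≤
      ‖(z - t 0) * ∏ j ∈ Finset.range (m + d), samplingFactor t j z‖ := by
  have hL0 : 0 ≤ L := (abs_nonneg _).trans (ht 0)
  have hx := abs_le.1 hm
  have ha (i : ℕ) : 0 ≤ (z.re - m + 1 - L + i) / (1 + L + i) :=
    div_nonneg (by linarith [i.cast_nonneg (α := ℝ)]) (by positivity)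
  have hb (i : ℕ) : 0 ≤ (m + 1 - L - z.re + i) / (m + 1 - L + i) := by
    apply div_nonneg <;> linarith [i.cast_nonneg (α := ℝ)]
  have hc (j : ℕ) : 0 ≤ (1 + L + z.re + j) / (1 + L + j) := by positivity
  have hgain (i : ℕ) : 0 ≤ verticalGain z.im i := Real.sqrt_nonneg _
  rw [norm_mul_prod_samplingFactor]
  calc _ ≤ ‖z - t m‖ * ((∏ i ∈ Finset.range m, (z.re - m + 1 - L + i) / (1 + L + i)) *
          (∏ i ∈ Finset.range d, (m + 1 - L - z.re + i) / (m + 1 - L + i)) *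
          ∏ j ∈ Finset.range (m + d), (1 + L + z.re + j) / (1 + L + j)) *
        ((∏ i ∈ Finset.range m, verticalGain z.im i) *
          (∏ i ∈ Finset.range d, verticalGain z.im i) *
          ∏ j ∈ Finset.range (m + d), verticalGain z.im (m + j)) := by
        refine mul_le_mul_of_nonneg_left (prod_verticalGain_sq_le z.im m d)
          (mul_nonneg (norm_nonneg _) (mul_nonneg (mul_nonneg ?_ ?_) ?_))
        exacts [Finset.prod_nonneg fun i _ => ha i, Finset.prod_nonneg fun i _ => hb i,
          Finset.prod_nonneg fun j _ => hc j]
    _ = ‖z - t m‖ * (∏ i ∈ Finset.range m,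
          ((z.re - m + 1 - L + i) / (1 + L + i) * verticalGain z.im i)) *
        (∏ i ∈ Finset.range d,
          ((m + 1 - L - z.re + i) / (m + 1 - L + i) * verticalGain z.im i)) *
        ∏ j ∈ Finset.range (m + d),
          ((1 + L + z.re + j) / (1 + L + j) * verticalGain z.im (m + j)) := by
        simp only [Finset.prod_mul_distrib]
        ring
    _ ≤ _ := by
        exact mul_le_mul
          (mul_le_mul (norm_sub_node_mul_le_mul_prod hL ht hm)
            (Finset.prod_le_prod (fun i _ => mul_nonneg (hb i) (hgain i))
              fun i _ => le_norm_one_sub_div_node hL ht hz hm i)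
            (Finset.prod_nonneg fun i _ => mul_nonneg (hb i) (hgain i)) (by positivity))
          (Finset.prod_le_prod (fun j _ => mul_nonneg (hc j) (hgain _))
            fun j _ => le_norm_one_sub_div_node_neg hL ht hz hm j)
          (Finset.prod_nonneg fun j _ => mul_nonneg (hc j) (hgain _)) (by positivity)

end PartialProducts

lemma prod_range_add_div_add {u s : ℝ} (hu : 0 < u) (hs : 0 < s) (n : ℕ) :
    ∏ i ∈ Finset.range n, (u + i) / (s + i) =
      Real.Gamma (u + n) / Real.Gamma u * (Real.Gamma s / Real.Gamma (s + n)) := by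
  rw [Finset.prod_div_distrib, prod_range_add_eq_Gamma_div hu, prod_range_add_eq_Gamma_div hs,
    div_div_eq_mul_div, mul_div_assoc]

lemma rpow_le_Gamma_div_Gamma {x L : ℝ} (hx : 0 ≤ x) (hL0 : 0 ≤ L) (hL : L < 1 / 2) :
    (1 + x) ^ (-(2 * L)) ≤ Real.Gamma (x + 1 - L) / Real.Gamma (x + 1 + L) := by
  have hu : 0 < x + 1 - L := by linarith
  rw [le_div_iff₀ (Real.Gamma_pos_of_pos (by linarith)), Real.rpow_neg (by linarith),
    inv_mul_le_iff₀ (by positivity)]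
  calc Real.Gamma (x + 1 + L) = Real.Gamma (x + 1 - L + 2 * L) := by ring_nf
    _ ≤ (x + 1 - L) ^ (2 * L) * Real.Gamma (x + 1 - L) :=
      Gamma_add_le_rpow_mul_Gamma hu (by linarith) (by linarith)
    _ ≤ (1 + x) ^ (2 * L) * Real.Gamma (x + 1 - L) := by
      have := Real.Gamma_pos_of_pos hu
      gcongr
      linarith

/-- The constant in the lower bound for `samplingG`: the infimum over `|δ| ≤ 1 / 2` of the factor
`Γ(1 + L)² / (Γ(1 - L - δ) Γ(1 - L + δ))` that comes from the nodes near `z`. -/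
noncomputable def samplingConst (L : ℝ) : ℝ :=
  Real.Gamma (1 + L) ^ 2 / (Real.Gamma (1 - L - 1 / 2) * Real.Gamma (1 - L + 1 / 2))

lemma samplingConst_pos {L : ℝ} (hL0 : 0 ≤ L) (hL : L < 1 / 2) : 0 < samplingConst L :=
  div_pos (pow_pos (Real.Gamma_pos_of_pos (by linarith)) 2)
    (mul_pos (Real.Gamma_pos_of_pos (by linarith)) (Real.Gamma_pos_of_pos (by linarith)))

lemma prod_nodeRatio_eq_Gamma {L x : ℝ} {m : ℕ} (hL0 : 0 ≤ L) (hL : L < 1 / 2) (hx : 0 ≤ x)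
    (hm : |x - m| ≤ 1 / 2) (d : ℕ) :
    (∏ i ∈ Finset.range m, (x - m + 1 - L + i) / (1 + L + i)) *
        (∏ i ∈ Finset.range d, (m + 1 - L - x + i) / (m + 1 - L + i)) *
        ∏ j ∈ Finset.range (m + d), (1 + L + x + j) / (1 + L + j) =
      Real.Gamma (1 + L) ^ 2 / (Real.Gamma (1 - L - (x - m)) * Real.Gamma (1 - L + (x - m))) *
        (Real.Gamma (x + 1 - L) / Real.Gamma (x + 1 + L) *
          (Real.Gamma (m + 1 - L) / Real.Gamma (m + 1 + L))) *
        (Real.Gamma (m + d + 1 - (L + x)) * Real.Gamma (m + d + 1 + (L + x)) /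
          (Real.Gamma (m + d + 1 - L) * Real.Gamma (m + d + 1 + L))) := by
  have hδ := abs_le.1 hm
  rw [prod_range_add_div_add (by linarith) (by linarith),
    prod_range_add_div_add (by linarith) (by linarith),
    prod_range_add_div_add (by linarith) (by linarith)]
  push_cast
  ring_nf

lemma samplingConst_mul_rpow_le_prod_nodeRatio {L x : ℝ} {m : ℕ} (hL0 : 0 ≤ L) (hL : L < 1 / 2)
    (hx : 0 ≤ x) (hm : |x - m| ≤ 1 / 2) (d : ℕ) :
    samplingConst L * ((1 + x) ^ (-(2 * L)) * (1 + m) ^ (-(2 * L))) ≤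
      (∏ i ∈ Finset.range m, (x - m + 1 - L + i) / (1 + L + i)) *
        (∏ i ∈ Finset.range d, (m + 1 - L - x + i) / (m + 1 - L + i)) *
        ∏ j ∈ Finset.range (m + d), (1 + L + x + j) / (1 + L + j) := by
  have hδ := abs_le.1 hm
  have hm0 : (0 : ℝ) ≤ m := m.cast_nonneg
  have hΓ {u : ℝ} (hu : 0 < u) : 0 < Real.Gamma u := Real.Gamma_pos_of_pos hu
  have hnear : Real.Gamma (1 - L - (x - m)) * Real.Gamma (1 - L + (x - m)) ≤
      Real.Gamma (1 - L - 1 / 2) * Real.Gamma (1 - L + 1 / 2) :=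
    Gamma_sub_mul_Gamma_add_le hm (by linarith)
  have hfar : Real.Gamma (m + d + 1 - L) * Real.Gamma (m + d + 1 + L) ≤
      Real.Gamma (m + d + 1 - (L + x)) * Real.Gamma (m + d + 1 + (L + x)) :=
    Gamma_sub_mul_Gamma_add_le (abs_le.2 ⟨by linarith, by linarith⟩) (by linarith)
  have hnear_pos := mul_pos (hΓ (u := 1 - L - (x - m)) (by linarith))
    (hΓ (u := 1 - L + (x - m)) (by linarith))
  have hfar_pos := mul_pos (hΓ (u := m + d + 1 - L) (by linarith))
    (hΓ (u := m + d + 1 + L) (by linarith))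
  have hratio_x := rpow_le_Gamma_div_Gamma hx hL0 hL
  have hratio_m := rpow_le_Gamma_div_Gamma hm0 hL0 hL
  have hpow_x : 0 < (1 + x) ^ (-(2 * L)) := by positivity
  rw [prod_nodeRatio_eq_Gamma hL0 hL hx hm]
  refine (mul_le_mul (div_le_div_of_nonneg_left (sq_nonneg _) hnear_pos hnear)
    (mul_le_mul hratio_x hratio_m (by positivity) (hpow_x.le.trans hratio_x))
    (by positivity) (by positivity)).trans
    (le_mul_of_one_le_right ?_ ((one_le_div hfar_pos).2 hfar))
  have hpos_x := hpow_x.trans_le hratio_x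
  have hpos_m := (by positivity : (0 : ℝ) < (1 + m) ^ (-(2 * L))).trans_le hratio_m
  positivity

section LowerBound

variable {t : ℤ → ℝ} {L : ℝ}

lemma norm_samplingG_ge_of_re_nonneg (hL : L < 1 / 2) (ht : ∀ k, |t k - k| ≤ L) {z : ℂ} {m : ℤ}
    (hz : 0 ≤ z.re) (hm : |z.re - m| ≤ 1 / 2) :
    ‖z - t m‖ * (samplingConst L * ((1 + |z.re|) ^ (-(2 * L)) * (1 + |(m : ℝ)|) ^ (-(2 * L)))) *
        (Real.exp (Real.pi * |z.im|) / ((1 + 2 * (Real.pi * |z.im|)) * (1 + z.im ^ 2))) ≤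
      ‖samplingG t z‖ := by
  have hm0 : 0 ≤ m := by
    have hneg : (-1 : ℝ) < m := by linarith [(abs_le.1 hm).2]
    exact Int.le_of_sub_one_lt (mod_cast hneg)
  lift m to ℕ using hm0
  rw [Int.cast_natCast] at hm
  have hL0 : 0 ≤ L := (abs_nonneg _).trans (ht 0)
  have hc := samplingConst_pos hL0 hL
  rw [abs_of_nonneg hz, Int.cast_natCast, Nat.abs_cast]
  have hexp : Real.exp (Real.pi * |z.im|) / ((1 + 2 * (Real.pi * |z.im|)) * (1 + z.im ^ 2)) ≤
      (∏' j : ℕ, (1 + z.im ^ 2 / ((j : ℝ) + 1) ^ 2)) / (1 + z.im ^ 2) := by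
    rw [← div_div]
    gcongr
    exact (div_le_iff₀' (by positivity)).2 (exp_pi_mul_abs_le_tprod z.im)
  refine (mul_le_mul_of_nonneg_left hexp (by positivity)).trans ?_
  refine le_of_tendsto_of_tendsto' ((tendsto_prod_verticalGain_sq z.im).const_mul _)
    ((tendsto_mul_prod_samplingFactor hL ht z).comp
      (tendsto_atTop_mono (fun d => d.le_add_left m) tendsto_id)).norm fun d => ?_
  refine le_trans ?_ (norm_sub_node_mul_prod_le_norm_partialProduct hL ht hz hm d)
  gcongr ?_ * ?_ * _
  exact samplingConst_mul_rpow_le_prod_nodeRatio hL0 hL hz hm d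

theorem norm_samplingG_ge (hL : L < 1 / 2) (ht : ∀ k, |t k - k| ≤ L) {z : ℂ} {m : ℤ}
    (hm : |z.re - m| ≤ 1 / 2) :
    ‖z - t m‖ * (samplingConst L * ((1 + |z.re|) ^ (-(2 * L)) * (1 + |(m : ℝ)|) ^ (-(2 * L)))) *
        (Real.exp (Real.pi * |z.im|) / ((1 + 2 * (Real.pi * |z.im|)) * (1 + z.im ^ 2))) ≤
      ‖samplingG t z‖ := by
  rcases le_total 0 z.re with hz | hz
  · exact norm_samplingG_ge_of_re_nonneg hL ht hz hm
  · have ht' (k : ℤ) : |-t (-k) - k| ≤ L := by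
      rw [abs_sub_comm]
      simpa [add_comm] using ht (-k)
    have hm' : |(-z).re - (-m : ℤ)| ≤ 1 / 2 := by
      rwa [Complex.neg_re, Int.cast_neg, neg_sub_neg, abs_sub_comm]
    simpa [samplingG_reflect, neg_add_eq_sub, norm_sub_rev, abs_neg] using
      norm_samplingG_ge_of_re_nonneg hL ht' (by simpa using hz) hm'

lemma samplingG_eq_zero_iff (hL : L < 1 / 2) (ht : ∀ k, |t k - k| ≤ L) {z : ℂ} :
    samplingG t z = 0 ↔ ∃ m, z = t m := by
  refine ⟨fun h => ⟨round z.re, ?_⟩, fun ⟨m, hm⟩ => hm ▸ samplingG_apply_node hL ht m⟩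
  have hL0 : 0 ≤ L := (abs_nonneg _).trans (ht 0)
  have hc := samplingConst_pos hL0 hL
  have hge := norm_samplingG_ge hL ht (abs_sub_round z.re)
  by_contra hne
  have hsub : 0 < ‖z - t (round z.re)‖ := norm_pos_iff.2 (sub_ne_zero.2 hne)
  rw [h, norm_zero] at hge
  exact hge.not_gt (by positivity)

lemma rpow_mul_rpow_le_norm_deriv_samplingG (hL : L < 1 / 2) (ht : ∀ k, |t k - k| ≤ L) (m : ℤ) :
    samplingConst L * ((1 + |t m|) ^ (-(2 * L)) * (1 + |(m : ℝ)|) ^ (-(2 * L))) ≤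
      ‖deriv (samplingG t) (t m)‖ := by
  let bound (w : ℂ) : ℝ :=
    samplingConst L * ((1 + |w.re|) ^ (-(2 * L)) * (1 + |(m : ℝ)|) ^ (-(2 * L))) *
      (Real.exp (Real.pi * |w.im|) / ((1 + 2 * (Real.pi * |w.im|)) * (1 + w.im ^ 2)))
  have hbound : ContinuousAt bound (t m) := by
    have hpow : Continuous fun w : ℂ => (1 + |w.re|) ^ (-(2 * L)) :=
      (by fun_prop : Continuous fun w : ℂ => 1 + |w.re|).rpow_const fun w => .inl (by positivity)
    exact (continuousAt_const.mul (hpow.continuousAt.mul continuousAt_const)).mul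
      (ContinuousAt.div (by fun_prop) (by fun_prop) (by positivity))
  have hnear : ∀ᶠ w : ℂ in 𝓝[≠] (t m : ℂ), |w.re - m| < 1 / 2 :=
    (ContinuousAt.eventually_lt (f := fun w : ℂ => |w.re - m|) (by fun_prop) continuousAt_const
      (by simpa using (ht m).trans_lt hL)).filter_mono nhdsWithin_le_nhds
  have hslope := (hasDerivAt_iff_tendsto_slope.1
    (differentiable_samplingG hL ht (t m)).hasDerivAt).norm
  have hlim : bound (t m) ≤ ‖deriv (samplingG t) (t m)‖ := by
    refine le_of_tendsto_of_tendsto (hbound.tendsto.mono_left nhdsWithin_le_nhds) hslope ?_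
    filter_upwards [hnear, self_mem_nhdsWithin] with w hw hne
    rw [slope_def_field, samplingG_apply_node hL ht, sub_zero, norm_div,
      le_div_iff₀ (norm_pos_iff.2 (sub_ne_zero.2 hne)), mul_comm, ← mul_assoc]
    exact norm_samplingG_ge hL ht hw.le
  simpa [bound] using hlim

lemma norm_deriv_samplingG_ge (hL : L < 1 / 2) (ht : ∀ k, |t k - k| ≤ L) (m : ℤ) :
    samplingConst L / 2 * (1 + |t m|) ^ (-(4 * L)) ≤ ‖deriv (samplingG t) (t m)‖ := by
  have hL0 : 0 ≤ L := (abs_nonneg _).trans (ht 0)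
  have hc := samplingConst_pos hL0 hL
  have hm1 : 1 + |(m : ℝ)| ≤ 2 * (1 + |t m|) := by
    linarith [abs_intCast_le_two_mul_abs_node hL ht m]
  have htwo : (1 : ℝ) / 2 ≤ 2 ^ (-(2 * L)) := by
    rw [one_div, ← Real.rpow_neg_one]
    exact Real.rpow_le_rpow_of_exponent_le one_le_two (by linarith)
  calc samplingConst L / 2 * (1 + |t m|) ^ (-(4 * L))
      = samplingConst L *
          ((1 + |t m|) ^ (-(2 * L)) * (1 / 2 * (1 + |t m|) ^ (-(2 * L)))) := by
        rw [mul_left_comm _ (1 / 2 : ℝ), ← Real.rpow_add (by positivity)]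
        ring_nf
    _ ≤ samplingConst L *
          ((1 + |t m|) ^ (-(2 * L)) * (2 ^ (-(2 * L)) * (1 + |t m|) ^ (-(2 * L)))) := by gcongr
    _ ≤ samplingConst L * ((1 + |t m|) ^ (-(2 * L)) * (1 + |(m : ℝ)|) ^ (-(2 * L))) := by
        rw [← Real.mul_rpow zero_le_two (by positivity)]
        gcongr ?_ * (?_ * ?_)
        exact Real.rpow_le_rpow_of_nonpos (by positivity) hm1 (by linarith)
    _ ≤ ‖deriv (samplingG t) (t m)‖ := rpow_mul_rpow_le_norm_deriv_samplingG hL ht m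

lemma deriv_samplingG_ne_zero (hL : L < 1 / 2) (ht : ∀ k, |t k - k| ≤ L) (m : ℤ) :
    deriv (samplingG t) (t m) ≠ 0 := by
  have hc := samplingConst_pos ((abs_nonneg _).trans (ht 0)) hL
  exact norm_pos_iff.1 (lt_of_lt_of_le (by positivity) (norm_deriv_samplingG_ge hL ht m))

lemma half_sub_le_norm_sub_node (ht : ∀ k, |t k - k| ≤ L) {z : ℂ} {N : ℕ} (hz : ‖z‖ = N + 1 / 2)
    (k : ℤ) : 1 / 2 - L ≤ ‖z - t k‖ := by
  have hhalf : (1 : ℝ) / 2 ≤ abs ((N : ℝ) + 1 / 2 - |(k : ℝ)|) := by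
    rw [← Int.cast_abs, le_abs]
    rcases le_or_gt |k| N with hk | hk
    · have : |(k : ℝ)| ≤ N := mod_cast hk
      exact .inl (by push_cast; linarith)
    · have : (N : ℝ) + 1 ≤ |(k : ℝ)| := mod_cast hk
      exact .inr (by push_cast; linarith)
  have hk : ‖(t k : ℂ) - k‖ ≤ L := by
    rw [← Complex.ofReal_intCast, ← Complex.ofReal_sub, Complex.norm_real]
    exact ht k
  have hzk := abs_norm_sub_norm_le z k
  rw [hz, Complex.norm_intCast] at hzk
  linarith [norm_sub_le_norm_sub_add_norm_sub z (t k) k]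

lemma inv_le_one_add_rpow_neg {a b : ℝ} (ha : 0 ≤ a) (hab : 1 + a ≤ b) (hL : L ≤ 1 / 2) :
    b⁻¹ ≤ (1 + a) ^ (-(2 * L)) := by
  rw [Real.rpow_neg (by positivity)]
  gcongr
  refine le_trans ?_ hab
  simpa using Real.rpow_le_rpow_of_exponent_le (le_add_of_nonneg_right ha)
    (by linarith : 2 * L ≤ 1)

lemma exists_pos_mul_exp_le_of_norm_eq (hL : L < 1 / 2) (ht : ∀ k, |t k - k| ≤ L) :
    ∃ c > 0, ∀ (N : ℕ) (z : ℂ), ‖z‖ = N + 1 / 2 →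
      c * Real.exp (Real.pi * |z.im|) ≤ (1 + ‖z‖) ^ 5 * ‖samplingG t z‖ := by
  have hL0 : 0 ≤ L := (abs_nonneg _).trans (ht 0)
  have hc := samplingConst_pos hL0 hL
  refine ⟨(1 / 2 - L) * samplingConst L / (4 * Real.pi), by positivity, fun N z hz => ?_⟩
  have hre := Complex.abs_re_le_norm z
  have him := Complex.abs_im_le_norm z
  have hround : |(round z.re : ℝ)| ≤ |z.re| + 1 / 2 := by
    have := abs_sub_abs_le_abs_sub (round z.re : ℝ) z.re
    rw [abs_sub_comm] at this
    linarith [abs_sub_round z.re]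
  have hpi : 1 + 2 * (Real.pi * |z.im|) ≤ 2 * Real.pi * (1 + ‖z‖) := by
    have := mul_le_mul_of_nonneg_left him Real.pi_pos.le
    linarith [Real.pi_gt_three]
  have hsq : 1 + z.im ^ 2 ≤ (1 + ‖z‖) ^ 2 := by
    have := pow_le_pow_left₀ (abs_nonneg _) him 2
    rw [sq_abs] at this
    nlinarith [norm_nonneg z]
  calc (1 / 2 - L) * samplingConst L / (4 * Real.pi) * Real.exp (Real.pi * |z.im|)
      = (1 + ‖z‖) ^ 5 * ((1 / 2 - L) * (samplingConst L * ((1 + ‖z‖)⁻¹ * (2 * (1 + ‖z‖))⁻¹)) *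
          (Real.exp (Real.pi * |z.im|) / (2 * Real.pi * (1 + ‖z‖) * (1 + ‖z‖) ^ 2))) := by
        field_simp
        ring
    _ ≤ (1 + ‖z‖) ^ 5 * (‖z - t (round z.re)‖ * (samplingConst L *
          ((1 + |z.re|) ^ (-(2 * L)) * (1 + |(round z.re : ℝ)|) ^ (-(2 * L)))) *
          (Real.exp (Real.pi * |z.im|) / ((1 + 2 * (Real.pi * |z.im|)) * (1 + z.im ^ 2)))) := by
        gcongr
        · exact half_sub_le_norm_sub_node ht hz _
        · exact inv_le_one_add_rpow_neg (abs_nonneg _) (by linarith) hL.le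
        · exact inv_le_one_add_rpow_neg (abs_nonneg _) (by linarith) hL.le
    _ ≤ (1 + ‖z‖) ^ 5 * ‖samplingG t z‖ := by
        gcongr
        exact norm_samplingG_ge hL ht (abs_sub_round z.re)

end LowerBound

section MaximumModulus

variable {Q G : ℂ → ℂ}

/-- The quotient `Q / G` of two entire functions, with the singularities at the simple zeros of `G`
that are also zeros of `Q` removed. -/
noncomputable def entireQuotient (Q G : ℂ → ℂ) (z : ℂ) : ℂ :=
  if G z = 0 then deriv Q z / deriv G z else Q z / G z

lemma entireQuotient_of_ne_zero {z : ℂ} (hz : G z ≠ 0) : entireQuotient Q G z = Q z / G z :=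
  if_neg hz

lemma differentiable_dslope {f : ℂ → ℂ} (hf : Differentiable ℂ f) (a : ℂ) :
    Differentiable ℂ (dslope f a) :=
  differentiableOn_univ.1 ((Complex.differentiableOn_dslope univ_mem).2 hf.differentiableOn)

lemma differentiableAt_entireQuotient (hQ : Differentiable ℂ Q) (hG : Differentiable ℂ G) {a : ℂ}
    (ha : G a = 0 → Q a = 0 ∧ deriv G a ≠ 0) : DifferentiableAt ℂ (entireQuotient Q G) a := by
  by_cases hGa : G a = 0
  · obtain ⟨hQa, hdG⟩ := ha hGa
    have hslope : dslope G a a ≠ 0 := by rwa [dslope_same]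
    have hdQ := differentiable_dslope hQ a
    have hdG := differentiable_dslope hG a
    refine ((hdQ a).div (hdG a) hslope).congr_of_eventuallyEq ?_
    filter_upwards [hdG.continuous.continuousAt.eventually_ne hslope] with w hw
    rcases eq_or_ne w a with rfl | hne
    · simp [entireQuotient, hGa]
    · have hQw := sub_smul_dslope_of_zero hQa w
      have hGw := sub_smul_dslope_of_zero hGa w
      have hsub := sub_ne_zero.2 hne
      rw [smul_eq_mul] at hQw hGw
      rw [entireQuotient_of_ne_zero (hGw ▸ mul_ne_zero hsub hw), ← hQw, ← hGw,
        mul_div_mul_left _ _ hsub, Pi.div_apply]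
  · refine ((hQ a).div (hG a) hGa).congr_of_eventuallyEq ?_
    filter_upwards [hG.continuous.continuousAt.eventually_ne hGa] with w hw
    exact entireQuotient_of_ne_zero hw

theorem norm_le_mul_norm_of_forall_sphere (hQ : Differentiable ℂ Q) (hG : Differentiable ℂ G)
    {R M : ℝ} (hzero : ∀ a ∈ Metric.closedBall (0 : ℂ) R, G a = 0 → Q a = 0 ∧ deriv G a ≠ 0)
    (hsphere : ∀ z, ‖z‖ = R → G z ≠ 0 ∧ ‖Q z‖ ≤ M * ‖G z‖) {z : ℂ} (hz : ‖z‖ < R) :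
    ‖Q z‖ ≤ M * ‖G z‖ := by
  by_cases hGz : G z = 0
  · simp [hGz, (hzero z (by simpa using hz.le) hGz).1]
  have hR : R ≠ 0 := ((norm_nonneg z).trans_lt hz).ne'
  have hdiff : DiffContOnCl ℂ (entireQuotient Q G) (Metric.ball 0 R) := by
    refine DifferentiableOn.diffContOnCl fun a ha => ?_
    rw [closure_ball _ hR] at ha
    exact (differentiableAt_entireQuotient hQ hG (hzero a ha)).differentiableWithinAt
  have hquot := Complex.norm_le_of_forall_mem_frontier_norm_le Metric.isBounded_ball hdiff
    (C := M) (fun w hw => ?_) (subset_closure (mem_ball_zero_iff.2 hz))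
  · rwa [entireQuotient_of_ne_zero hGz, norm_div, div_le_iff₀ (norm_pos_iff.2 hGz)] at hquot
  · rw [frontier_ball _ hR, mem_sphere_zero_iff_norm] at hw
    obtain ⟨hGw, hle⟩ := hsphere w hw
    rwa [entireQuotient_of_ne_zero hGw, norm_div, div_le_iff₀ (norm_pos_iff.2 hGw)]

end MaximumModulus

section FastDecay

variable {t : ℤ → ℝ} {L C : ℝ} {P : ℂ → ℂ}

lemma injective_nodes (hL : L < 1 / 2) (ht : ∀ k, |t k - k| ≤ L) : Function.Injective t := by
  intro j k hjk
  have hdist : |(j : ℝ) - k| < 1 := by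
    have htriangle := abs_sub_le (j : ℝ) (t j) k
    have hj := ht j
    have hk := ht k
    rw [abs_sub_comm] at hj
    rw [← hjk] at hk
    linarith
  exact sub_eq_zero.1 (Int.abs_lt_one_iff.1 (mod_cast hdist))

lemma samplingKernel_of_ne {k : ℤ} {s : ℝ} (hs : s ≠ t k) :
    samplingKernel t k s = samplingG t s / (deriv (samplingG t) (t k) * (s - t k)) := if_neg hs

lemma samplingKernel_eq_dslope_div (hL : L < 1 / 2) (ht : ∀ k, |t k - k| ≤ L) (k : ℤ) (s : ℝ) :
    samplingKernel t k s = dslope (samplingG t) (t k) s / deriv (samplingG t) (t k) := by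
  rcases eq_or_ne s (t k) with rfl | hs
  · rw [dslope_same, div_self (deriv_samplingG_ne_zero hL ht k), samplingKernel, if_pos rfl]
  · rw [samplingKernel_of_ne hs, dslope_of_ne _ (mod_cast hs), slope_def_field,
      samplingG_apply_node hL ht, sub_zero, div_div, mul_comm]

lemma samplingKernel_node_of_ne (hL : L < 1 / 2) (ht : ∀ k, |t k - k| ≤ L) {k m : ℤ}
    (hkm : k ≠ m) : samplingKernel t k (t m) = 0 := by
  rw [samplingKernel_of_ne ((injective_nodes hL ht).ne hkm.symm), samplingG_apply_node hL ht,
    zero_div]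

lemma eventually_le_abs_node (ht : ∀ k, |t k - k| ≤ L) (X : ℝ) : ∀ᶠ k in cofinite, X ≤ |t k| := by
  have hlarge : ∀ᶠ k : ℤ in cofinite, X + L ≤ |(k : ℝ)| :=
    (tendsto_norm_cocompact_atTop.comp Int.tendsto_coe_cofinite).eventually_ge_atTop (X + L)
  filter_upwards [hlarge] with k hk
  have hdist := abs_sub_abs_le_abs_sub (k : ℝ) (t k)
  rw [abs_sub_comm] at hdist
  linarith [ht k]

lemma summable_one_add_abs_node_rpow (hL : L < 1 / 2) (ht : ∀ k, |t k - k| ≤ L) {a : ℝ}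
    (ha : 1 < a) : Summable fun k : ℤ => (1 + |t k|) ^ (-a) := by
  refine ((Real.summable_abs_int_rpow ha).mul_left (2 ^ a)).of_norm_bounded_eventually ?_
  filter_upwards [(finite_singleton (0 : ℤ)).compl_mem_cofinite] with k hk
  have hk0 : 0 < |(k : ℝ)| := abs_pos.2 (mod_cast hk)
  have hle : 2⁻¹ * |(k : ℝ)| ≤ 1 + |t k| := by
    linarith [abs_intCast_le_two_mul_abs_node hL ht k]
  calc ‖(1 + |t k|) ^ (-a)‖ = (1 + |t k|) ^ (-a) := Real.norm_of_nonneg (by positivity)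
    _ ≤ (2⁻¹ * |(k : ℝ)|) ^ (-a) :=
      Real.rpow_le_rpow_of_nonpos (by positivity) hle (by linarith)
    _ = 2 ^ a * |(k : ℝ)| ^ (-a) := by
      rw [Real.mul_rpow (by positivity) hk0.le, Real.inv_rpow zero_le_two,
        Real.rpow_neg zero_le_two, inv_inv]

lemma summable_mul_norm_coeff (hL : L < 1 / 2) (ht : ∀ k, |t k - k| ≤ L)
    (hP : ∀ z, (1 + ‖z‖) ^ 6 * ‖P z‖ ≤ C * Real.exp (Real.pi * |z.im|)) :
    Summable fun k : ℤ => (1 + |t k|) * ‖P (t k) / deriv (samplingG t) (t k)‖ := by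
  have hc := samplingConst_pos ((abs_nonneg _).trans (ht 0)) hL
  refine .of_norm_bounded ((summable_one_add_abs_node_rpow hL ht (a := 3) (by norm_num)).mul_left
    (2 * C / samplingConst L)) fun k => ?_
  have hPk : (1 + |t k|) ^ 6 * ‖P (t k)‖ ≤ C := by simpa using hP (t k)
  have hderiv : samplingConst L / 2 * ((1 + |t k|) ^ 2)⁻¹ ≤ ‖deriv (samplingG t) (t k)‖ := by
    refine le_trans ?_ (norm_deriv_samplingG_ge hL ht k)
    rw [← Real.rpow_natCast, ← Real.rpow_neg (by positivity)]
    gcongr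
    · exact le_add_of_nonneg_right (abs_nonneg _)
    · push_cast
      linarith
  have hC : 0 ≤ C := le_trans (by positivity) hPk
  calc ‖(1 + |t k|) * ‖P (t k) / deriv (samplingG t) (t k)‖‖
      = (1 + |t k|) * (‖P (t k)‖ / ‖deriv (samplingG t) (t k)‖) := by
        rw [Real.norm_of_nonneg (by positivity), norm_div]
    _ ≤ (1 + |t k|) * (C / (1 + |t k|) ^ 6 / (samplingConst L / 2 * ((1 + |t k|) ^ 2)⁻¹)) := by
        gcongr
        rwa [le_div_iff₀' (by positivity)]
    _ = 2 * C / samplingConst L * ((1 + |t k|) ^ 3)⁻¹ := by field_simp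
    _ = 2 * C / samplingConst L * (1 + |t k|) ^ (-3 : ℝ) := by
        rw [Real.rpow_neg (by positivity)]
        norm_cast

/-- The error of the `N`-th symmetric partial sum of the interpolation series of `P`. -/
noncomputable def interpolationError (t : ℤ → ℝ) (P : ℂ → ℂ) (N : ℕ) (z : ℂ) : ℂ :=
  P z - ∑ k ∈ Finset.Icc (-(N : ℤ)) N,
    P (t k) / deriv (samplingG t) (t k) * dslope (samplingG t) (t k) z

lemma differentiable_interpolationError (hL : L < 1 / 2) (ht : ∀ k, |t k - k| ≤ L)
    (hP : Differentiable ℂ P) (N : ℕ) : Differentiable ℂ (interpolationError t P N) :=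
  hP.sub (.fun_sum fun k _ =>
    (differentiable_dslope (differentiable_samplingG hL ht) (t k)).const_mul _)

lemma interpolationError_node (hL : L < 1 / 2) (ht : ∀ k, |t k - k| ≤ L) {N : ℕ} {m : ℤ}
    (hm : |m| ≤ N) : interpolationError t P N (t m) = 0 := by
  rw [interpolationError, Finset.sum_eq_single m, dslope_same,
    div_mul_cancel₀ _ (deriv_samplingG_ne_zero hL ht m), sub_self]
  · intro k _ hk
    have h := samplingKernel_node_of_ne hL ht hk
    rw [samplingKernel_eq_dslope_div hL ht, div_eq_zero_iff] at h
    rw [h.resolve_right (deriv_samplingG_ne_zero hL ht k), mul_zero]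
  · exact fun h => absurd (Finset.mem_Icc.2 (abs_le.1 hm)) h

lemma norm_dslope_samplingG_le (hL : L < 1 / 2) (ht : ∀ k, |t k - k| ≤ L) {z : ℂ} {N : ℕ}
    (hz : ‖z‖ = N + 1 / 2) (k : ℤ) :
    ‖dslope (samplingG t) (t k) z‖ ≤
      (1 / 2 - L)⁻¹ * (1 + |t k|) / (N + 1 / 2) * ‖samplingG t z‖ := by
  have hL0 : 0 ≤ L := (abs_nonneg _).trans (ht 0)
  have hsub : 0 < 1 / 2 - L := by linarith
  have hge := half_sub_le_norm_sub_node ht hz k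
  have hpos : 0 < ‖z - t k‖ := hsub.trans_le hge
  have hne : z ≠ t k := sub_ne_zero.1 (norm_pos_iff.1 hpos)
  have hN : (N : ℝ) + 1 / 2 ≤ (1 / 2 - L)⁻¹ * (1 + |t k|) * ‖z - t k‖ := by
    have htriangle : ‖z‖ ≤ ‖z - t k‖ + |t k| := by
      simpa using norm_add_le (z - t k) (t k)
    rw [mul_assoc, ← div_eq_inv_mul, le_div_iff₀ hsub, ← hz]
    nlinarith [abs_nonneg (t k)]
  rw [dslope_of_ne _ hne, slope_def_field, samplingG_apply_node hL ht, sub_zero, norm_div,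
    div_eq_inv_mul]
  gcongr
  rw [inv_le_comm₀ hpos (by positivity), inv_div, div_le_iff₀ (by positivity)]
  linarith

lemma exists_norm_interpolationError_le_of_norm_eq (hL : L < 1 / 2) (ht : ∀ k, |t k - k| ≤ L)
    (hP : ∀ z, (1 + ‖z‖) ^ 6 * ‖P z‖ ≤ C * Real.exp (Real.pi * |z.im|)) :
    ∃ B, ∀ (N : ℕ) (z : ℂ), ‖z‖ = N + 1 / 2 →
      ‖interpolationError t P N z‖ ≤ B / (N + 1 / 2) * ‖samplingG t z‖ := by
  obtain ⟨c, hc, hG⟩ := exists_pos_mul_exp_le_of_norm_eq hL ht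
  have hsum := summable_mul_norm_coeff hL ht hP
  have hC : 0 ≤ C := (by positivity : 0 ≤ (1 + ‖(0 : ℂ)‖) ^ 6 * ‖P 0‖).trans (by simpa using hP 0)
  set S := ∑' k : ℤ, (1 + |t k|) * ‖P (t k) / deriv (samplingG t) (t k)‖
  refine ⟨C / c + (1 / 2 - L)⁻¹ * S, fun N z hz => ?_⟩
  have hPz : ‖P z‖ ≤ C / c / (N + 1 / 2) * ‖samplingG t z‖ := by
    have hmul : (1 + ‖z‖) ^ 5 * (c * ((1 + ‖z‖) * ‖P z‖)) ≤
        (1 + ‖z‖) ^ 5 * (C * ‖samplingG t z‖) := by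
      linarith [mul_le_mul_of_nonneg_left (hP z) hc.le, mul_le_mul_of_nonneg_left (hG N z hz) hC]
    have hle := le_of_mul_le_mul_left hmul (by positivity)
    rw [div_div, div_mul_eq_mul_div, le_div_iff₀ (by positivity), ← hz]
    nlinarith [norm_nonneg (P z)]
  have hpartial : ∑ k ∈ Finset.Icc (-(N : ℤ)) N,
      (1 + |t k|) * ‖P (t k) / deriv (samplingG t) (t k)‖ ≤ S :=
    hsum.sum_le_tsum _ fun k _ => by positivity
  calc ‖interpolationError t P N z‖
      ≤ ‖P z‖ + ∑ k ∈ Finset.Icc (-(N : ℤ)) N,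
          ‖P (t k) / deriv (samplingG t) (t k)‖ * ‖dslope (samplingG t) (t k) z‖ :=
        (norm_sub_le _ _).trans (add_le_add_right
          ((norm_sum_le _ _).trans_eq (by simp only [norm_mul])) _)
    _ ≤ C / c / (N + 1 / 2) * ‖samplingG t z‖ + ∑ k ∈ Finset.Icc (-(N : ℤ)) N,
          ‖P (t k) / deriv (samplingG t) (t k)‖ *
            ((1 / 2 - L)⁻¹ * (1 + |t k|) / (N + 1 / 2) * ‖samplingG t z‖) := by
        gcongr
        exact norm_dslope_samplingG_le hL ht hz _
    _ = (C / c + (1 / 2 - L)⁻¹ * ∑ k ∈ Finset.Icc (-(N : ℤ)) N,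
          (1 + |t k|) * ‖P (t k) / deriv (samplingG t) (t k)‖) / (N + 1 / 2) *
            ‖samplingG t z‖ := by
        rw [add_div, add_mul, Finset.mul_sum, Finset.sum_div, Finset.sum_mul]
        congr 1
        exact Finset.sum_congr rfl fun k _ => by ring
    _ ≤ (C / c + (1 / 2 - L)⁻¹ * S) / (N + 1 / 2) * ‖samplingG t z‖ := by gcongr

lemma tendsto_interpolationError (hL : L < 1 / 2) (ht : ∀ k, |t k - k| ≤ L)
    (hPd : Differentiable ℂ P)
    (hP : ∀ z, (1 + ‖z‖) ^ 6 * ‖P z‖ ≤ C * Real.exp (Real.pi * |z.im|)) (z : ℂ) :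
    Tendsto (fun N => interpolationError t P N z) atTop (𝓝 0) := by
  obtain ⟨B, hB⟩ := exists_norm_interpolationError_le_of_norm_eq hL ht hP
  have hlim : Tendsto (fun N : ℕ => B / ((N : ℝ) + 1 / 2) * ‖samplingG t z‖) atTop (𝓝 0) := by
    simpa using ((tendsto_atTop_add_const_right _ (1 / 2 : ℝ)
      tendsto_natCast_atTop_atTop).const_div_atTop B).mul_const ‖samplingG t z‖
  refine squeeze_zero_norm' ?_ hlim
  filter_upwards [tendsto_natCast_atTop_atTop.eventually_ge_atTop ‖z‖] with N hN
  refine norm_le_mul_norm_of_forall_sphere (differentiable_interpolationError hL ht hPd N)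
    (differentiable_samplingG hL ht) (fun a ha hGa => ?_) (fun w hw => ⟨fun hGw => ?_, hB N w hw⟩)
    (R := N + 1 / 2) (by linarith)
  · obtain ⟨m, rfl⟩ := (samplingG_eq_zero_iff hL ht).1 hGa
    refine ⟨interpolationError_node hL ht ?_, deriv_samplingG_ne_zero hL ht m⟩
    rw [mem_closedBall_zero_iff, Complex.norm_real, Real.norm_eq_abs] at ha
    have hdist := abs_sub_abs_le_abs_sub (m : ℝ) (t m)
    rw [abs_sub_comm] at hdist
    have hlt : |(m : ℝ)| < N + 1 := by linarith [ht m]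
    exact Int.lt_add_one_iff.1 (mod_cast hlt)
  · obtain ⟨m, rfl⟩ := (samplingG_eq_zero_iff hL ht).1 hGw
    have hdist := half_sub_le_norm_sub_node ht hw m
    rw [sub_self, norm_zero] at hdist
    linarith

theorem hasSum_samplingKernel_of_fast_decay (hL : L < 1 / 2) (ht : ∀ k, |t k - k| ≤ L)
    (hPd : Differentiable ℂ P)
    (hP : ∀ z, (1 + ‖z‖) ^ 6 * ‖P z‖ ≤ C * Real.exp (Real.pi * |z.im|)) {s : ℝ}
    (hs : Summable fun k => P (t k) * samplingKernel t k s) :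
    HasSum (fun k => P (t k) * samplingKernel t k s) (P s) := by
  have hlim := (tendsto_interpolationError hL ht hPd hP s).const_sub (P s)
  simp only [interpolationError, sub_sub_cancel, sub_zero] at hlim
  convert! hs.hasSum
  refine tendsto_nhds_unique ?_ (hs.hasSum.comp (Finset.tendsto_Icc_neg (R := ℤ)))
  refine hlim.congr fun N => Finset.sum_congr rfl fun k _ => ?_
  simp only [samplingKernel_eq_dslope_div hL ht]
  ring

end FastDecay

section Sinc

/-- The entire function `sin w / w`, with the value `1` at `0`. -/
noncomputable def complexSinc : ℂ → ℂ := dslope Complex.sin 0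

lemma complexSinc_zero : complexSinc 0 = 1 := by
  simp [complexSinc]

lemma differentiable_complexSinc : Differentiable ℂ complexSinc :=
  differentiable_dslope Complex.differentiable_sin 0

lemma mul_complexSinc (w : ℂ) : w * complexSinc w = Complex.sin w := by
  simpa [complexSinc] using sub_smul_dslope_of_zero Complex.sin_zero w

lemma norm_exp_mul_I_le (w : ℂ) : ‖Complex.exp (w * Complex.I)‖ ≤ Real.exp |w.im| := by
  rw [Complex.norm_exp]
  simpa using neg_le_abs w.im

lemma norm_sin_le_exp_abs_im (w : ℂ) : ‖Complex.sin w‖ ≤ Real.exp |w.im| := by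
  have hsub := norm_sub_le (Complex.exp (-w * Complex.I)) (Complex.exp (w * Complex.I))
  have hneg := norm_exp_mul_I_le (-w)
  rw [Complex.neg_im, abs_neg] at hneg
  rw [Complex.sin, norm_div, norm_mul, Complex.norm_I, mul_one, Complex.norm_two]
  linarith [norm_exp_mul_I_le w]

lemma norm_cos_le_exp_abs_im (w : ℂ) : ‖Complex.cos w‖ ≤ Real.exp |w.im| := by
  have hadd := norm_add_le (Complex.exp (w * Complex.I)) (Complex.exp (-w * Complex.I))
  have hneg := norm_exp_mul_I_le (-w)
  rw [Complex.neg_im, abs_neg] at hneg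
  rw [Complex.cos, norm_div, Complex.norm_two]
  linarith [norm_exp_mul_I_le w]

lemma norm_complexSinc_le (w : ℂ) : ‖complexSinc w‖ ≤ Real.exp |w.im| := by
  rcases eq_or_ne w 0 with rfl | hw
  · simp [complexSinc_zero]
  have hseg : ‖Complex.sin w - Complex.sin 0‖ ≤ Real.exp |w.im| * ‖w - 0‖ := by
    refine (convex_segment 0 w).norm_image_sub_le_of_norm_deriv_le
      (fun z _ => Complex.differentiable_sin z) (fun z hz => ?_) (left_mem_segment ℝ 0 w)
      (right_mem_segment ℝ 0 w)
    rw [segment_eq_image] at hz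
    obtain ⟨r, ⟨hr0, hr1⟩, rfl⟩ := hz
    rw [Complex.deriv_sin]
    refine (norm_cos_le_exp_abs_im _).trans (Real.exp_le_exp.2 ?_)
    simpa [abs_mul, abs_of_nonneg hr0] using mul_le_of_le_one_left (abs_nonneg w.im) hr1
  rw [Complex.sin_zero, sub_zero, sub_zero, ← mul_complexSinc, norm_mul, mul_comm] at hseg
  exact le_of_mul_le_mul_right hseg (norm_pos_iff.2 hw)

lemma one_add_norm_mul_norm_complexSinc_le (w : ℂ) :
    (1 + ‖w‖) * ‖complexSinc w‖ ≤ 2 * Real.exp |w.im| := by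
  have hsin := norm_sin_le_exp_abs_im w
  rw [← mul_complexSinc, norm_mul] at hsin
  linarith [norm_complexSinc_le w]

end Sinc

section SlowDecay

variable {t : ℤ → ℝ} {L C : ℝ} {P : ℂ → ℂ}

lemma continuous_samplingKernel (hL : L < 1 / 2) (ht : ∀ k, |t k - k| ≤ L) (k : ℤ) :
    Continuous (samplingKernel t k) := by
  simp only [funext (samplingKernel_eq_dslope_div hL ht k)]
  exact ((differentiable_dslope (differentiable_samplingG hL ht) (t k)).continuous.comp
    Complex.continuous_ofReal).div_const _

lemma eventually_norm_samplingKernel_le (hL : L < 1 / 2) (ht : ∀ k, |t k - k| ≤ L) {K : Set ℝ}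
    (hK : IsCompact K) :
    ∃ B, ∀ᶠ k in cofinite, ∀ s ∈ K,
      ‖samplingKernel t k s‖ ≤ (1 + |t k|) * (B * (1 + |t k|) ^ (-(2 - 4 * L))) := by
  have hc := samplingConst_pos ((abs_nonneg _).trans (ht 0)) hL
  obtain ⟨R, hR⟩ := hK.isBounded.exists_norm_le
  obtain ⟨M, hM⟩ := hK.exists_bound_of_continuousOn
    ((differentiable_samplingG hL ht).continuous.comp Complex.continuous_ofReal).continuousOn
  refine ⟨4 * M / samplingConst L, ?_⟩
  filter_upwards [eventually_le_abs_node ht (2 * R + 1)] with k hk s hs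
  have hsR : |s| ≤ R := hR s hs
  have hdist : (1 + |t k|) / 2 ≤ ‖(s : ℂ) - t k‖ := by
    rw [← Complex.ofReal_sub, Complex.norm_real, Real.norm_eq_abs, abs_sub_comm]
    linarith [abs_sub_abs_le_abs_sub (t k) s]
  have hne : s ≠ t k := by
    rintro rfl
    linarith [abs_nonneg (t k)]
  have hM0 : 0 ≤ M := (norm_nonneg _).trans (hM s hs)
  rw [samplingKernel_of_ne hne, norm_div, norm_mul]
  calc _ ≤ M / (samplingConst L / 2 * (1 + |t k|) ^ (-(4 * L)) * ((1 + |t k|) / 2)) := by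
        gcongr
        · exact hM s hs
        · exact norm_deriv_samplingG_ge hL ht k
    _ = (1 + |t k|) * (4 * M / samplingConst L * (1 + |t k|) ^ (-(2 - 4 * L))) := by
        rw [neg_sub, Real.rpow_sub (by positivity), Real.rpow_neg (by positivity),
          Real.rpow_two]
        field_simp
        ring

lemma exists_summable_norm_samplingKernel_le (hL : L < 1 / 4) (ht : ∀ k, |t k - k| ≤ L)
    {K : Set ℝ} (hK : IsCompact K) :
    ∃ w : ℤ → ℝ, Summable w ∧ ∀ k, ∀ s ∈ K, ‖samplingKernel t k s‖ ≤ (1 + |t k|) * w k := by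
  have hL' : L < 1 / 2 := by linarith
  obtain ⟨B, hB⟩ := eventually_norm_samplingKernel_le hL' ht hK
  choose M hM using fun k =>
    hK.exists_bound_of_continuousOn (continuous_samplingKernel hL' ht k).continuousOn
  have hw (k : ℤ) : ∃ w, (∀ s ∈ K, ‖samplingKernel t k s‖ ≤ (1 + |t k|) * w) ∧
      ((∀ s ∈ K, ‖samplingKernel t k s‖ ≤ (1 + |t k|) * (B * (1 + |t k|) ^ (-(2 - 4 * L)))) →
        B * (1 + |t k|) ^ (-(2 - 4 * L)) = w) := by
    by_cases hk : ∀ s ∈ K, ‖samplingKernel t k s‖ ≤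
        (1 + |t k|) * (B * (1 + |t k|) ^ (-(2 - 4 * L)))
    · exact ⟨_, hk, fun _ => rfl⟩
    · refine ⟨M k / (1 + |t k|), fun s hs => ?_, fun h => absurd h hk⟩
      rw [mul_div_cancel₀ _ (by positivity)]
      exact hM k s hs
  choose w hw hw' using hw
  exact ⟨w, ((summable_one_add_abs_node_rpow hL' ht (by linarith)).mul_left B).congr_cofinite
    (hB.mono hw'), hw⟩

/-- A regularization of a function `P` of exponential type `π` that has the same type but gains a
factor `O(‖z‖⁻⁵)`: the dilation frees exactly the type `π ε` spent by the five `sinc` factors. -/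
noncomputable def regularization (P : ℂ → ℂ) (ε : ℝ) (z : ℂ) : ℂ :=
  P ((1 - ε : ℝ) * z) * complexSinc ((Real.pi * ε / 5 : ℝ) * z) ^ 5

lemma differentiable_regularization (hP : Differentiable ℂ P) (ε : ℝ) :
    Differentiable ℂ (regularization P ε) :=
  (hP.comp (differentiable_id.const_mul _)).mul
    ((differentiable_complexSinc.comp (differentiable_id.const_mul _)).pow 5)

lemma mul_one_add_norm_le {r : ℝ} (hr0 : 0 ≤ r) (hr1 : r ≤ 1) (z : ℂ) :
    r * (1 + ‖z‖) ≤ 1 + ‖(r : ℂ) * z‖ := by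
  rw [norm_mul, Complex.norm_of_nonneg hr0]
  linarith

lemma norm_regularization_ofReal_le (hP : ∀ z, (1 + ‖z‖) * ‖P z‖ ≤ C * Real.exp (Real.pi * |z.im|))
    {ε : ℝ} (hε0 : 0 ≤ ε) (hε : ε ≤ 1 / 2) (x : ℝ) :
    (1 + |x|) * ‖regularization P ε x‖ ≤ 2 * C := by
  have hsinc : ‖complexSinc ((Real.pi * ε / 5 : ℝ) * (x : ℂ))‖ ≤ 1 := by
    simpa only [← Complex.ofReal_mul, Complex.ofReal_im, abs_zero, Real.exp_zero] using
      norm_complexSinc_le ((Real.pi * ε / 5 * x : ℝ) : ℂ)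
  have hPx : (1 + ‖((1 - ε : ℝ) : ℂ) * x‖) * ‖P ((1 - ε : ℝ) * x)‖ ≤ C := by
    simpa only [← Complex.ofReal_mul, Complex.ofReal_im, abs_zero, mul_zero, Real.exp_zero,
      mul_one] using hP ((1 - ε : ℝ) * x)
  have hdil := mul_one_add_norm_le (r := 1 - ε) (by linarith) (by linarith) x
  rw [Complex.norm_real, Real.norm_eq_abs] at hdil
  rw [regularization, norm_mul, norm_pow]
  calc (1 + |x|) * (‖P ((1 - ε : ℝ) * x)‖ * ‖complexSinc ((Real.pi * ε / 5 : ℝ) * x)‖ ^ 5)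
      ≤ 2 * (1 + ‖((1 - ε : ℝ) : ℂ) * x‖) * (‖P ((1 - ε : ℝ) * x)‖ * 1) := by
        gcongr
        · nlinarith [abs_nonneg x]
        · exact pow_le_one₀ (norm_nonneg _) hsinc
    _ ≤ 2 * C := by linarith

lemma exists_norm_regularization_le
    (hP : ∀ z, (1 + ‖z‖) * ‖P z‖ ≤ C * Real.exp (Real.pi * |z.im|)) {ε : ℝ} (hε0 : 0 < ε)
    (hε : ε < 1) :
    ∃ B, ∀ z, (1 + ‖z‖) ^ 6 * ‖regularization P ε z‖ ≤ B * Real.exp (Real.pi * |z.im|) := by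
  set δ := Real.pi * ε / 5 with hδ
  have hδ0 : 0 < δ := by positivity
  have hδ1 : δ ≤ 1 := by nlinarith [Real.pi_lt_four]
  have hε' : 0 < 1 - ε := by linarith
  refine ⟨C / (1 - ε) * (2 / δ) ^ 5, fun z => ?_⟩
  have hdil := (mul_le_mul_of_nonneg_right (mul_one_add_norm_le hε'.le (by linarith) z)
    (norm_nonneg _)).trans (hP ((1 - ε : ℝ) * z))
  have hsinc := (mul_le_mul_of_nonneg_right (mul_one_add_norm_le hδ0.le hδ1 z)
    (norm_nonneg _)).trans (one_add_norm_mul_norm_complexSinc_le (δ * z))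
  rw [Complex.im_ofReal_mul, abs_mul, abs_of_pos hε', mul_assoc, ← le_div_iff₀' hε'] at hdil
  rw [Complex.im_ofReal_mul, abs_mul, abs_of_pos hδ0, mul_assoc, ← le_div_iff₀' hδ0] at hsinc
  rw [regularization, norm_mul, norm_pow]
  calc (1 + ‖z‖) ^ 6 * (‖P ((1 - ε : ℝ) * z)‖ * ‖complexSinc (δ * z)‖ ^ 5)
      = (1 + ‖z‖) * ‖P ((1 - ε : ℝ) * z)‖ * ((1 + ‖z‖) * ‖complexSinc (δ * z)‖) ^ 5 := by ring
    _ ≤ C * Real.exp (Real.pi * ((1 - ε) * |z.im|)) / (1 - ε) *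
          (2 * Real.exp (δ * |z.im|) / δ) ^ 5 := by
        gcongr
        exact le_trans (by positivity) hdil
    _ = C / (1 - ε) * (2 / δ) ^ 5 *
          (Real.exp (Real.pi * ((1 - ε) * |z.im|)) * Real.exp (δ * |z.im|) ^ 5) := by ring
    _ = C / (1 - ε) * (2 / δ) ^ 5 * Real.exp (Real.pi * |z.im|) := by
        rw [← Real.exp_nat_mul, ← Real.exp_add, hδ]
        ring_nf

lemma tendsto_regularization (hP : Continuous P) (z : ℂ) :
    Tendsto (fun ε => regularization P ε z) (𝓝[>] 0) (𝓝 (P z)) := by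
  have hcont : Continuous fun ε => regularization P ε z := by
    have := differentiable_complexSinc.continuous
    unfold regularization
    fun_prop
  simpa [regularization, complexSinc_zero] using (hcont.tendsto 0).mono_left nhdsWithin_le_nhds

lemma norm_mul_le_of_weighted {r B v : ℝ} {a b : ℂ} (hr : 0 < r) (ha : r * ‖a‖ ≤ B)
    (hb : ‖b‖ ≤ r * v) : ‖a * b‖ ≤ B * v := by
  have hv : 0 ≤ v := nonneg_of_mul_nonneg_right ((norm_nonneg b).trans hb) hr
  calc ‖a * b‖ ≤ ‖a‖ * (r * v) := by rw [norm_mul]; gcongr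
    _ = r * ‖a‖ * v := by ring
    _ ≤ B * v := by gcongr

lemma hasSum_samplingKernel (hL : L < 1 / 4) (ht : ∀ k, |t k - k| ≤ L) (hPd : Differentiable ℂ P)
    (hP : ∀ z, (1 + ‖z‖) * ‖P z‖ ≤ C * Real.exp (Real.pi * |z.im|)) (s : ℝ) :
    HasSum (fun k => P (t k) * samplingKernel t k s) (P s) := by
  obtain ⟨w, hw, hle⟩ := exists_summable_norm_samplingKernel_le hL ht (isCompact_singleton (x := s))
  have hdom {Q : ℂ → ℂ} {B : ℝ} (hQ : ∀ x : ℝ, (1 + |x|) * ‖Q x‖ ≤ B) (k : ℤ) :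
      ‖Q (t k) * samplingKernel t k s‖ ≤ B * w k :=
    norm_mul_le_of_weighted (by positivity) (hQ (t k)) (hle k s rfl)
  have hsmall : ∀ᶠ ε : ℝ in 𝓝[>] 0, 0 < ε ∧ ε < 1 / 2 := Ioo_mem_nhdsGT (by norm_num)
  have hreg : ∀ᶠ ε : ℝ in 𝓝[>] 0,
      ∑' k, regularization P ε (t k) * samplingKernel t k s = regularization P ε s := by
    filter_upwards [hsmall] with ε ⟨hε0, hε⟩
    obtain ⟨B, hB⟩ := exists_norm_regularization_le hP hε0 (by linarith)
    exact (hasSum_samplingKernel_of_fast_decay (by linarith) ht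
      (differentiable_regularization hPd ε) hB (.of_norm_bounded (hw.mul_left (2 * C))
        (hdom (norm_regularization_ofReal_le hP hε0.le hε.le)))).tsum_eq
  have htsum : Tendsto (fun ε => ∑' k, regularization P ε (t k) * samplingKernel t k s) (𝓝[>] 0)
      (𝓝 (∑' k, P (t k) * samplingKernel t k s)) := by
    refine tendsto_tsum_of_dominated_convergence (hw.mul_left (2 * C))
      (fun k => (tendsto_regularization hPd.continuous (t k)).mul_const _) ?_
    filter_upwards [hsmall] with ε ⟨hε0, hε⟩
    exact hdom (norm_regularization_ofReal_le hP hε0.le hε.le)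
  have hPreal : ∀ x : ℝ, (1 + |x|) * ‖P x‖ ≤ C := fun x => by simpa using hP x
  rw [← tendsto_nhds_unique (htsum.congr' hreg) (tendsto_regularization hPd.continuous s)]
  exact (Summable.of_norm_bounded (hw.mul_left C) (hdom hPreal)).hasSum

theorem hasSumUniformlyOn_samplingKernel (hL : L < 1 / 4) (ht : ∀ k, |t k - k| ≤ L)
    (hPd : Differentiable ℂ P)
    (hP : ∀ z, (1 + ‖z‖) * ‖P z‖ ≤ C * Real.exp (Real.pi * |z.im|)) {K : Set ℝ} (hK : IsCompact K) :
    HasSumUniformlyOn (fun (k : ℤ) (s : ℝ) => P (t k) * samplingKernel t k s)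
      (fun s => P s) K := by
  obtain ⟨w, hw, hle⟩ := exists_summable_norm_samplingKernel_le hL ht hK
  have hPreal : ∀ x : ℝ, (1 + |x|) * ‖P x‖ ≤ C := fun x => by simpa using hP x
  exact (HasSumUniformlyOn.of_norm_le_summable (hw.mul_left C) fun k s hs =>
    norm_mul_le_of_weighted (by positivity) (hPreal (t k)) (hle k s hs)).congr_right fun s _ =>
      (hasSum_samplingKernel hL ht hPd hP s).tsum_eq

end SlowDecay

section Taylor

variable {φ : ℕ → ℝ → ℂ} {σ M : ℝ}

/-- The Taylor polynomial of degree less than `n` of `φ 0` at the real point `x`, evaluated at the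
complex point `u`. The function `φ k` stands for the `k`-th derivative of `φ 0`. -/
noncomputable def taylorPartial (φ : ℕ → ℝ → ℂ) (u : ℂ) (n : ℕ) (x : ℝ) : ℂ :=
  ∑ k ∈ Finset.range n, φ k x * ((u - x) ^ k / (k.factorial : ℂ))

lemma hasDerivAt_taylorPartial (hφ : ∀ k x, HasDerivAt (φ k) (φ (k + 1) x) x) (u : ℂ) (n : ℕ)
    (x : ℝ) : HasDerivAt (taylorPartial φ u (n + 1))
      (φ (n + 1) x * ((u - x) ^ n / (n.factorial : ℂ))) x := by
  induction n with
  | zero =>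
    have hconst : taylorPartial φ u (0 + 1) = φ 0 := by
      ext y
      simp [taylorPartial]
    simpa [hconst] using hφ 0 x
  | succ n ih =>
    have hsucc : taylorPartial φ u (n + 1 + 1) = fun y => taylorPartial φ u (n + 1) y
        + φ (n + 1) y * ((u - y) ^ (n + 1) / ((n + 1).factorial : ℂ)) := by
      ext y
      simp [taylorPartial, Finset.sum_range_succ]
    have hlin : HasDerivAt (fun y : ℝ => u - (y : ℂ)) (-1) x := by
      simpa using (Complex.ofRealCLM.hasDerivAt (x := x)).const_sub u
    have hpow := (hlin.fun_pow (n + 1)).div_const ((n + 1).factorial : ℂ)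
    rw [hsucc]
    refine (ih.add ((hφ (n + 1) x).mul hpow)).congr_deriv ?_
    have hn : (n.factorial : ℂ) ≠ 0 := by exact_mod_cast n.factorial_ne_zero
    have hn1 : (n : ℂ) + 1 ≠ 0 := by exact_mod_cast n.succ_ne_zero
    rw [Nat.factorial_succ]
    push_cast
    field_simp
    ring

lemma norm_taylor_term_le (hφb : ∀ k x, ‖φ k x‖ ≤ σ ^ k * M) {w : ℂ} {B : ℝ} (hw : ‖w‖ ≤ B)
    (k : ℕ) (x : ℝ) :
    ‖φ k x * (w ^ k / (k.factorial : ℂ))‖ ≤ M * ((σ * B) ^ k / k.factorial) := by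
  rw [norm_mul, norm_div, norm_pow, Complex.norm_natCast, mul_pow]
  calc ‖φ k x‖ * (‖w‖ ^ k / k.factorial) ≤ (σ ^ k * M) * (B ^ k / k.factorial) := by
        gcongr
        · exact (norm_nonneg _).trans (hφb k x)
        · exact hφb k x
    _ = M * (σ ^ k * B ^ k / k.factorial) := by ring

lemma summable_taylor (hφb : ∀ k x, ‖φ k x‖ ≤ σ ^ k * M) (w : ℂ) (x : ℝ) :
    Summable fun k => φ k x * (w ^ k / (k.factorial : ℂ)) :=
  Summable.of_norm_bounded ((Real.summable_pow_div_factorial (σ * ‖w‖)).mul_left M)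
    fun k => norm_taylor_term_le hφb le_rfl k x

/-- As a function of the centre, the Taylor polynomial at `u` has a derivative consisting of a
single term, which tends to `0`; so the Taylor series does not depend on the centre. -/
lemma tsum_taylor_eq (hφ : ∀ k x, HasDerivAt (φ k) (φ (k + 1) x) x)
    (hφb : ∀ k x, ‖φ k x‖ ≤ σ ^ k * M) (u : ℂ) (X : ℝ) :
    ∑' k, φ k X * ((u - X) ^ k / (k.factorial : ℂ))
      = ∑' k, φ k 0 * (u ^ k / (k.factorial : ℂ)) := by
  set B := ‖u‖ + |X|
  have hbound (n : ℕ) : ‖taylorPartial φ u (n + 1) X - taylorPartial φ u (n + 1) 0‖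
      ≤ σ * M * ((σ * B) ^ n / n.factorial) * ‖X - 0‖ := by
    refine (convex_uIcc (0 : ℝ) X).norm_image_sub_le_of_norm_hasDerivWithin_le
      (fun y _ => (hasDerivAt_taylorPartial hφ u n y).hasDerivWithinAt) (fun y hy => ?_)
      left_mem_uIcc right_mem_uIcc
    have hyX : |y| ≤ |X| := by simpa using abs_sub_left_of_mem_uIcc hy
    have hdist : ‖u - y‖ ≤ B := by
      refine (norm_sub_le _ _).trans ?_
      rw [Complex.norm_real, Real.norm_eq_abs]
      exact add_le_add le_rfl hyX
    exact norm_taylor_term_le (φ := fun k => φ (k + 1)) (M := σ * M)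
      (fun k x => (hφb (k + 1) x).trans_eq (by ring)) hdist n y
  have hlim (x : ℝ) : Tendsto (fun n => taylorPartial φ u (n + 1) x) atTop
      (𝓝 (∑' k, φ k x * ((u - x) ^ k / (k.factorial : ℂ)))) :=
    ((summable_taylor hφb (u - x) x).hasSum.tendsto_sum_nat).comp (tendsto_add_atTop_nat 1)
  have hzero : Tendsto (fun n : ℕ => σ * M * ((σ * B) ^ n / n.factorial) * ‖X - 0‖) atTop
      (𝓝 0) := by
    simpa using ((FloorSemiring.tendsto_pow_div_factorial_atTop (σ * B)).const_mul
      (σ * M)).mul_const ‖X - 0‖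
  simpa [sub_eq_zero] using
    tendsto_nhds_unique ((hlim X).sub (hlim 0)) (squeeze_zero_norm hbound hzero)

theorem exists_entire_extension (hφ : ∀ k x, HasDerivAt (φ k) (φ (k + 1) x) x)
    (hφb : ∀ k x, ‖φ k x‖ ≤ σ ^ k * M) :
    ∃ E : ℂ → ℂ, Differentiable ℂ E ∧ (∀ x : ℝ, E x = φ 0 x) ∧
      ∀ z, ‖E z‖ ≤ M * Real.exp (σ * |z.im|) := by
  refine ⟨fun z => ∑' k, φ k 0 * (z ^ k / (k.factorial : ℂ)), fun z => ?_, fun x => ?_,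
    fun z => ?_⟩
  · have hball := Complex.differentiableOn_tsum_of_summable_norm
      (F := fun k z => φ k 0 * (z ^ k / (k.factorial : ℂ))) (U := Metric.ball 0 (‖z‖ + 1))
      ((Real.summable_pow_div_factorial (σ * (‖z‖ + 1))).mul_left M)
      (fun k => by fun_prop) Metric.isOpen_ball
      (fun k w hw => norm_taylor_term_le hφb (mem_ball_zero_iff.1 hw).le k 0)
    exact hball.differentiableAt (Metric.isOpen_ball.mem_nhds (by simp))
  · dsimp only
    rw [← tsum_taylor_eq hφ hφb x x, tsum_eq_single 0 fun k hk => by simp [hk]]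
    simp
  · dsimp only
    -- Expanding at `re z` leaves only the imaginary part in the exponential series.
    rw [← tsum_taylor_eq hφ hφb z z.re]
    have hexp : HasSum (fun k : ℕ => M * ((σ * |z.im|) ^ k / k.factorial))
        (M * Real.exp (σ * |z.im|)) := by
      rw [Real.exp_eq_exp_ℝ]
      exact (NormedSpace.expSeries_div_hasSum_exp (σ * |z.im|)).mul_left M
    have him : z - z.re = z.im * Complex.I := by
      apply Complex.ext <;> simp
    exact tsum_of_norm_bounded hexp fun k => norm_taylor_term_le hφb (by simp [him]) k _

lemma exists_one_add_norm_mul_norm_dslope_zero_le {E : ℂ → ℂ} (hE : Differentiable ℂ E) (hσ : 0 ≤ σ)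
    (hEb : ∀ z, ‖E z‖ ≤ M * Real.exp (σ * |z.im|)) :
    ∃ C, ∀ z, (1 + ‖z‖) * ‖dslope E 0 z‖ ≤ C * Real.exp (σ * |z.im|) := by
  have hM : 0 ≤ M := by simpa using (norm_nonneg _).trans (hEb 0)
  obtain ⟨B, hB⟩ := (isCompact_closedBall (0 : ℂ) 1).exists_bound_of_continuousOn
    (differentiable_dslope hE 0).continuous.continuousOn
  have hexp (z : ℂ) : 1 ≤ Real.exp (σ * |z.im|) := Real.one_le_exp (by positivity)
  have hmul (z : ℂ) : ‖z‖ * ‖dslope E 0 z‖ ≤ 2 * M * Real.exp (σ * |z.im|) := by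
    have hz : z * dslope E 0 z = E z - E 0 := by simpa using sub_smul_dslope E 0 z
    have hE0 : ‖E 0‖ ≤ M := by simpa using hEb 0
    rw [← norm_mul, hz]
    linarith [norm_sub_le (E z) (E 0), hEb z, le_mul_of_one_le_right hM (hexp z)]
  refine ⟨|B| + 4 * M, fun z => ?_⟩
  rcases le_or_gt ‖z‖ 1 with hz | hz
  · have hBz := (hB z (by simpa using hz)).trans (le_abs_self B)
    nlinarith [hmul z, le_mul_of_one_le_right (abs_nonneg B) (hexp z), Real.exp_pos (σ * |z.im|)]
  · nlinarith [hmul z, norm_nonneg (dslope E 0 z), abs_nonneg B, Real.exp_pos (σ * |z.im|)]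

end Taylor

section Pairing

variable {p q : ℝ} {a b g : ℝ → ℂ}

lemma map_mul_left_volume_restrict_Ioi {c : ℝ} (hc : 0 < c) :
    Measure.map (c * ·) (volume.restrict (Ioi (0 : ℝ)))
      = ENNReal.ofReal c⁻¹ • volume.restrict (Ioi (0 : ℝ)) := by
  have hmap := (measurableEmbedding_mulLeft₀ hc.ne').restrict_map volume (Ioi (0 : ℝ))
  have hpre : (c * ·) ⁻¹' (Ioi (0 : ℝ)) = Ioi 0 := by
    ext x
    simp [hc]
  rw [hpre, Real.map_volume_mul_left hc.ne', Measure.restrict_smul,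
    abs_of_pos (inv_pos.2 hc)] at hmap
  exact hmap.symm

lemma mellinTranslate_mul_rpow_ae_eq (p s : ℝ) (a : ℝ → ℂ) :
    (fun x : ℝ => mellinTranslate s a x * ((x ^ (-1 / p) : ℝ) : ℂ))
      =ᵐ[volume.restrict (Ioi (0 : ℝ))] (((Real.exp s) ^ (1 / p) : ℝ) : ℂ) •
        ((fun x : ℝ => a x * ((x ^ (-1 / p) : ℝ) : ℂ)) ∘ (Real.exp s * ·)) := by
  filter_upwards [ae_restrict_mem measurableSet_Ioi] with x hx
  have hs := Real.exp_pos s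
  simp only [mellinTranslate, Pi.smul_apply, Function.comp_apply, smul_eq_mul]
  rw [Real.mul_rpow hs.le (mem_Ioi.1 hx).le, mul_left_comm, ← Complex.ofReal_mul, ← mul_assoc,
    ← Real.rpow_add hs, neg_div, add_neg_cancel, Real.rpow_zero, one_mul]

lemma mellinXNorm_mellinTranslate (hp : 0 < p) (s : ℝ) (a : ℝ → ℂ) :
    mellinXNorm p (mellinTranslate s a) = mellinXNorm p a := by
  have hs := Real.exp_pos s
  have hinv : (1 / ENNReal.ofReal p).toReal = 1 / p := by
    rw [ENNReal.toReal_div, ENNReal.toReal_ofReal hp.le, ENNReal.toReal_one]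
  unfold mellinXNorm
  rw [eLpNorm_congr_ae (mellinTranslate_mul_rpow_ae_eq p s a), eLpNorm_const_smul,
    ← (measurableEmbedding_mulLeft₀ hs.ne').eLpNorm_map_measure,
    map_mul_left_volume_restrict_Ioi hs, eLpNorm_smul_measure_of_ne_top ENNReal.ofReal_ne_top,
    smul_eq_mul, ← mul_assoc, hinv, ENNReal.ofReal_rpow_of_pos (inv_pos.2 hs),
    Real.inv_rpow hs.le, ← ofReal_norm, Complex.norm_of_nonneg (by positivity),
    ← ENNReal.ofReal_mul (by positivity), mul_inv_cancel₀ (by positivity), ENNReal.ofReal_one,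
    one_mul]

lemma MemMellinX.mellinTranslate (hp : 0 < p) (ha : MemMellinX p a) (s : ℝ) :
    MemMellinX p (mellinTranslate s a) := by
  have hs := Real.exp_pos s
  refine ⟨AEStronglyMeasurable.congr (AEStronglyMeasurable.const_smul ?_ _)
    (mellinTranslate_mul_rpow_ae_eq p s a).symm,
    (mellinXNorm_mellinTranslate hp s a).trans_lt ha.2⟩
  rw [← (measurableEmbedding_mulLeft₀ hs.ne').aestronglyMeasurable_map_iff,
    map_mul_left_volume_restrict_Ioi hs]
  exact ha.1.smul_measure _

lemma mul_div_ae_eq_smul (hpq : 1 / p + 1 / q = 1) (a g : ℝ → ℂ) :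
    (fun x : ℝ => a x * g x / (x : ℂ)) =ᵐ[volume.restrict (Ioi (0 : ℝ))]
      (fun x : ℝ => a x * ((x ^ (-1 / p) : ℝ) : ℂ)) •
        (fun x : ℝ => g x * ((x ^ (-1 / q) : ℝ) : ℂ)) := by
  filter_upwards [ae_restrict_mem measurableSet_Ioi] with x hx
  have hexp : -1 / p + -1 / q = -1 := by linear_combination -hpq
  have hinv : (x : ℂ)⁻¹ = ((x ^ (-1 / p) : ℝ) : ℂ) * ((x ^ (-1 / q) : ℝ) : ℂ) := by
    rw [← Complex.ofReal_mul, ← Real.rpow_add hx, hexp, Real.rpow_neg_one, Complex.ofReal_inv]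
  simp only [Pi.smul_apply', smul_eq_mul]
  rw [div_eq_mul_inv, hinv]
  ring

lemma holderTriple_ofReal (hp : 1 < p) (hpq : 1 / p + 1 / q = 1) :
    ENNReal.HolderTriple (ENNReal.ofReal p) (ENNReal.ofReal q) 1 :=
  (Real.holderConjugate_iff.2 ⟨hp, by simpa using hpq⟩ : p.HolderConjugate q).ennrealOfReal

lemma MemMellinX.integrableOn_mul (hp : 1 < p) (hpq : 1 / p + 1 / q = 1) (ha : MemMellinX p a)
    (hg : MemMellinX q g) : IntegrableOn (fun x : ℝ => a x * g x / (x : ℂ)) (Ioi (0 : ℝ)) := by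
  have := holderTriple_ofReal hp hpq
  exact (memLp_one_iff_integrable.1 (hg.smul ha)).congr (mul_div_ae_eq_smul hpq a g).symm

lemma MemMellinX.enorm_integral_mul_le (hp : 1 < p) (hpq : 1 / p + 1 / q = 1)
    (ha : MemMellinX p a) (hg : MemMellinX q g) :
    ‖∫ x in Ioi (0 : ℝ), a x * g x / (x : ℂ)‖ₑ ≤ mellinXNorm p a * mellinXNorm q g := by
  have := holderTriple_ofReal hp hpq
  refine (enorm_integral_le_lintegral_enorm _).trans ?_
  rw [← eLpNorm_one_eq_lintegral_enorm, eLpNorm_congr_ae (mul_div_ae_eq_smul hpq a g)]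
  exact eLpNorm_smul_le_mul_eLpNorm hg.1 ha.1

lemma MemMellinX.norm_mellinPhi_le (hp : 1 < p) (hpq : 1 / p + 1 / q = 1)
    (ha : MemMellinX p a) (hg : MemMellinX q g) (s : ℝ) :
    ‖mellinPhi a g s‖ ≤ (mellinXNorm p a * mellinXNorm q g).toReal := by
  have hle := (ha.mellinTranslate (by linarith) s).enorm_integral_mul_le hp hpq hg
  rw [mellinXNorm_mellinTranslate (by linarith)] at hle
  rw [← toReal_enorm]
  exact ENNReal.toReal_mono (ENNReal.mul_ne_top ha.2.ne hg.2.ne) hle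

lemma MemMellinX.sub (ha : MemMellinX p a) (hb : MemMellinX p b) :
    MemMellinX p (fun x => a x - b x) := by
  simp only [MemMellinX, sub_mul]
  exact MemLp.sub ha hb

lemma MemMellinX.div_const (ha : MemMellinX p a) (c : ℂ) :
    MemMellinX p (fun x => a x / c) := by
  unfold MemMellinX
  simpa only [div_eq_inv_mul, mul_assoc] using MemLp.const_mul ha c⁻¹

lemma mellinPhi_slope_sub (hp : 1 < p) (hpq : 1 / p + 1 / q = 1) (ha : MemMellinX p a)
    (hb : MemMellinX p b) (hg : MemMellinX q g) (s h : ℝ) :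
    h⁻¹ • (mellinPhi a g (s + h) - mellinPhi a g s) - mellinPhi b g s
      = mellinPhi (fun x => (mellinTranslate h a x - a x) / (h : ℂ) - b x) g s := by
  have hint {c : ℝ → ℂ} (hc : MemMellinX p c) (r : ℝ) :=
    (hc.mellinTranslate (by linarith) r).integrableOn_mul hp hpq hg
  unfold mellinPhi
  rw [← integral_sub (hint ha (s + h)) (hint ha s), ← integral_smul]
  refine (integral_sub (((hint ha (s + h)).sub (hint ha s)).smul h⁻¹) (hint hb s)).symm.trans ?_
  refine integral_congr_ae (Eventually.of_forall fun x => ?_)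
  have hexp : Real.exp (s + h) * x = Real.exp h * (Real.exp s * x) := by
    rw [Real.exp_add]
    ring
  simp only [mellinTranslate, Pi.smul_apply, Pi.sub_apply, Complex.real_smul, Complex.ofReal_inv,
    hexp]
  ring

theorem IsMellinTheta.hasDerivAt_mellinPhi (hp : 1 < p) (hpq : 1 / p + 1 / q = 1)
    (hab : IsMellinTheta p a b) (hg : MemMellinX q g) (s : ℝ) :
    HasDerivAt (mellinPhi a g) (mellinPhi b g s) s := by
  obtain ⟨ha, hb, hlim⟩ := hab
  have hdiff (h : ℝ) : MemMellinX p fun x => (mellinTranslate h a x - a x) / (h : ℂ) - b x :=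
    (((ha.mellinTranslate (by linarith) h).sub ha).div_const _).sub hb
  have hnorm : Tendsto (fun h : ℝ => (mellinXNorm p (fun x =>
      (mellinTranslate h a x - a x) / (h : ℂ) - b x) * mellinXNorm q g).toReal) (𝓝[≠] 0)
      (𝓝 0) := by
    have hmul := ENNReal.Tendsto.mul_const (b := mellinXNorm q g) hlim (Or.inr hg.2.ne)
    rw [zero_mul] at hmul
    exact (ENNReal.tendsto_toReal ENNReal.zero_ne_top).comp hmul
  rw [hasDerivAt_iff_tendsto_slope_zero, tendsto_iff_norm_sub_tendsto_zero]
  refine squeeze_zero (fun _ => norm_nonneg _) (fun h => ?_) hnorm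
  rw [mellinPhi_slope_sub hp hpq ha hb hg]
  exact (hdiff h).norm_mellinPhi_le hp hpq hg s

lemma MemMellinBernstein.isMellinTheta {σ : ℝ} {f : ℝ → ℂ} (hf : MemMellinBernstein p σ f) (k : ℕ) :
    IsMellinTheta p ((mellinTheta p)^[k] f) ((mellinTheta p)^[k + 1] f) := by
  have hex := (hf.1 (k + 1)).2 k (Nat.lt_succ_self k)
  rw [Function.iterate_succ_apply', mellinTheta, dif_pos hex]
  exact hex.choose_spec

lemma MemMellinBernstein.norm_mellinPhi_iterate_le {σ : ℝ} {f : ℝ → ℂ} (hp : 1 < p)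
    (hpq : 1 / p + 1 / q = 1) (hσ : 0 ≤ σ) (hf : MemMellinBernstein p σ f) (hg : MemMellinX q g)
    (k : ℕ) (s : ℝ) :
    ‖mellinPhi ((mellinTheta p)^[k] f) g s‖
      ≤ σ ^ k * (mellinXNorm p f * mellinXNorm q g).toReal := by
  refine ((hf.isMellinTheta k).1.norm_mellinPhi_le hp hpq hg s).trans ?_
  rw [← ENNReal.toReal_ofReal (pow_nonneg hσ k), ← ENNReal.toReal_mul, ← mul_assoc]
  exact ENNReal.toReal_mono (ENNReal.mul_ne_top (ENNReal.mul_ne_top ENNReal.ofReal_ne_top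
    (hf.1 0).1.2.ne) hg.2.ne) (mul_le_mul_left (hf.2 k) _)

lemma mellinTranslate_zero (a : ℝ → ℂ) : mellinTranslate 0 a = a := by
  ext x
  simp [mellinTranslate]

lemma mellinPsi_zero (p : ℝ) (a g : ℝ → ℂ) :
    mellinPsi p a g 0 = mellinPhi (mellinTheta p a) g 0 := by
  simp [mellinPsi, mellinPhi, mellinTranslate_zero]

lemma mellinPsi_of_ne (hp : 1 < p) (hpq : 1 / p + 1 / q = 1) (ha : MemMellinX p a)
    (hg : MemMellinX q g) {s : ℝ} (hs : s ≠ 0) :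
    mellinPsi p a g s = (mellinPhi a g s - mellinPhi a g 0) / s := by
  have hint (r : ℝ) := (ha.mellinTranslate (by linarith) r).integrableOn_mul hp hpq hg
  rw [mellinPsi, if_neg hs, mellinPhi, mellinPhi, ← integral_sub (hint s) (hint 0),
    ← integral_div]
  refine integral_congr_ae (Eventually.of_forall fun x => ?_)
  simp only [mellinTranslate_zero]
  ring

lemma ofReal_mul_mellinPsi (hp : 1 < p) (hpq : 1 / p + 1 / q = 1) (ha : MemMellinX p a)
    (hg : MemMellinX q g) (s : ℝ) :
    (s : ℂ) * mellinPsi p a g s = mellinPhi a g s - mellinPhi a g 0 := by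
  rcases eq_or_ne s 0 with rfl | hs
  · simp
  · rw [mellinPsi_of_ne hp hpq ha hg hs, mul_div_cancel₀ _ (Complex.ofReal_ne_zero.2 hs)]

theorem MemMellinBernstein.exists_entire_mellinPsi {σ : ℝ} {f : ℝ → ℂ} (hp : 1 < p)
    (hpq : 1 / p + 1 / q = 1) (hσ : 0 ≤ σ) (hf : MemMellinBernstein p σ f) (hg : MemMellinX q g) :
    ∃ (P : ℂ → ℂ) (C : ℝ), Differentiable ℂ P ∧ (∀ s : ℝ, P s = mellinPsi p f g s) ∧
      ∀ z, (1 + ‖z‖) * ‖P z‖ ≤ C * Real.exp (σ * |z.im|) := by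
  have hderiv (k : ℕ) (s : ℝ) := (hf.isMellinTheta k).hasDerivAt_mellinPhi hp hpq hg s
  obtain ⟨E, hE, hEreal, hEb⟩ :=
    exists_entire_extension hderiv (hf.norm_mellinPhi_iterate_le hp hpq hσ hg)
  obtain ⟨C, hC⟩ := exists_one_add_norm_mul_norm_dslope_zero_le hE hσ hEb
  refine ⟨dslope E 0, C, differentiable_dslope hE 0, fun s => ?_, hC⟩
  rcases eq_or_ne s 0 with rfl | hs
  · have hEderiv : HasDerivAt (fun x : ℝ => E x) (deriv E 0) 0 :=
      HasDerivAt.comp_ofReal (z := 0) (by simpa using (hE 0).hasDerivAt)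
    rw [funext hEreal] at hEderiv
    rw [Complex.ofReal_zero, dslope_same, hEderiv.unique (hderiv 0 0), mellinPsi_zero]
    rfl
  · rw [dslope_of_ne _ (Complex.ofReal_ne_zero.2 hs), slope_def_field, sub_zero, hEreal,
      ← Complex.ofReal_zero, hEreal, mellinPsi_of_ne hp hpq (hf.1 0).1 hg hs]
    rfl

end Pairing

lemma hasSumUniformlyOn_mul_of_bounded {ι α R : Type*} [SeminormedRing R] {F : ι → α → R}
    {S c : α → R} {K : Set α} {B : ℝ} (hc : ∀ s ∈ K, ‖c s‖ ≤ B) (h : HasSumUniformlyOn F S K) :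
    HasSumUniformlyOn (fun i s => c s * F i s) (fun s => c s * S s) K := by
  rw [hasSumUniformlyOn_iff_tendstoUniformlyOn, Metric.tendstoUniformlyOn_iff] at h ⊢
  intro ε hε
  have hB : 0 < |B| + 1 := by positivity
  filter_upwards [h (ε / (|B| + 1)) (by positivity)] with I hI s hs
  rw [← Finset.mul_sum, dist_eq_norm, ← mul_sub]
  calc ‖c s * (S s - ∑ i ∈ I, F i s)‖ ≤ (|B| + 1) * ‖S s - ∑ i ∈ I, F i s‖ := by
        refine (norm_mul_le _ _).trans ?_
        gcongr
        linarith [hc s hs, le_abs_self B]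
    _ < ε := (lt_div_iff₀' hB).1 (by simpa only [dist_eq_norm] using hI s hs)

theorem mainTheorem8 (t : ℤ → ℝ)
    (ht_bdd : BddAbove (Set.range fun k : ℤ => |t k - (k : ℝ)|))
    (ht : ⨆ k : ℤ, |t k - (k : ℝ)| < 1 / 4) :
    (HasProdLocallyUniformlyOn (samplingFactor t) (fun z => ∏' n : ℕ, samplingFactor t n z)
        Set.univ ∧
      Differentiable ℂ (samplingG t) ∧
      ∀ k : ℤ, deriv (samplingG t) (t k : ℂ) ≠ 0) ∧
    ∀ (p q : ℝ), 1 < p → 1 / p + 1 / q = 1 →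
      ∀ f g : ℝ → ℂ, MemMellinBernstein p Real.pi f → MemMellinX q g →
        (∀ s : ℝ, IntegrableOn (fun x : ℝ => mellinTranslate s f x * g x / (x : ℂ))
          (Set.Ioi (0 : ℝ))) ∧
        IntegrableOn (fun x : ℝ => mellinTheta p f x * g x / (x : ℂ)) (Set.Ioi (0 : ℝ)) ∧
        ∀ K : Set ℝ, IsCompact K →
          HasSumUniformlyOn (fun (k : ℤ) (s : ℝ) => mellinPsi p f g (t k) * samplingKernel t k s)
            (mellinPsi p f g) K ∧
          HasSumUniformlyOn
            (fun (k : ℤ) (s : ℝ) => (s : ℂ) * (mellinPsi p f g (t k) * samplingKernel t k s))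
            (fun s => mellinPhi f g s - mellinPhi f g 0) K := by
  have hle (k : ℤ) : |t k - k| ≤ ⨆ k : ℤ, |t k - (k : ℝ)| := le_ciSup ht_bdd k
  have hhalf : ⨆ k : ℤ, |t k - (k : ℝ)| < 1 / 2 := ht.trans (by norm_num)
  refine ⟨⟨hasProdLocallyUniformlyOn_samplingFactor hhalf hle, differentiable_samplingG hhalf hle,
    deriv_samplingG_ne_zero hhalf hle⟩, fun p q hp hpq f g hf hg => ?_⟩
  have hfX : MemMellinX p f := (hf.1 0).1
  refine ⟨fun s => (hfX.mellinTranslate (by linarith) s).integrableOn_mul hp hpq hg,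
    (hf.isMellinTheta 0).2.1.integrableOn_mul hp hpq hg, fun K hK => ?_⟩
  obtain ⟨P, C, hPd, hPreal, hPb⟩ := hf.exists_entire_mellinPsi hp hpq Real.pi_pos.le hg
  have hsum := hasSumUniformlyOn_samplingKernel ht hle hPd hPb hK
  simp only [hPreal] at hsum
  obtain ⟨B, hB⟩ := hK.exists_bound_of_continuousOn Complex.continuous_ofReal.continuousOn
  exact ⟨hsum, (hasSumUniformlyOn_mul_of_bounded hB hsum).congr_right fun s _ =>
    ofReal_mul_mellinPsi hp hpq hfX hg s⟩
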